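/- **Setting.** Let $\hat G$ be a finite group with a homomorphism $\pi:\hat G\to\{\pm1\}$, let $\hat H\le\hat G$ be a subgroup on which $\pi$ is still surjective, and put $G=\ker\pi$, $H=\hat H\cap G$. Let $k$ be a field in which $2|H|$ is invertible, and let $\hat\alpha:\hat G^3\to k^\times$ be a normalized $3$-cocycle with coefficients in $k^\times_\pi$, i.e. $\hat\alpha([\omega_3|\omega_2|\omega_1])=1$ if some $\omega_i=e$ and $$\hat\alpha([\omega_3|\omega_2|\omega_1])^{\pi(\omega_4)}\,\hat\alpha([\omega_4|\omega_3\omega_2|\omega_1])\,\hat\alpha([\omega_4|\omega_3|\omega_2])=\hat\alpha([\omega_4\omega_3|\omega_2|\omega_1])\,\hat\alpha([\omega_4|\omega_3|\omega_2\omega_1]).$$ For a $k$-linear category $V$ write ${}^{1}V=V$, ${}^{-1}V=V^{\mathrm{op}}$, and similarly for functors and natural transformations. **Real representations.** A linear Real representation $\rho$ on $V$ of the categorical group determined by $(\hat G,\hat\alpha)$, i.e. an $\hat\alpha$-twisted Real $2$-representation, consists of $k$-linear equivalences $\rho(\omega):{}^{\pi(\omega)}V\to V$ for $\omega\in\hat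 G$, natural isomorphisms $\psi_{\omega_2,\omega_1}:\rho(\omega_2)\circ{}^{\pi(\omega_2)}\rho(\omega_1)\Rightarrow\rho(\omega_2\omega_1)$ and $\psi_e:\rho(e)\Rightarrow 1_V$ with $$\hat\alpha([\omega_3|\omega_2|\omega_1])\;\psi_{\omega_3\omega_2,\omega_1}\,(\psi_{\omega_3,\omega_2}\circ\rho(\omega_1))=\psi_{\omega_3,\omega_2\omega_1}\,(\rho(\omega_3)\circ{}^{\pi(\omega_3)}\psi_{\omega_2,\omega_1}^{\pi(\omega_3)}),$$ $\psi_{e,\omega}=\psi_e\circ\rho(\omega)$ and $\psi_{\omega,e}=\rho(\omega)\circ{}^{\pi(\omega)}\psi_e^{\pi(\omega)}$. **Real $2$-characters.** For $g\in G$ let $\mathbb{T}\mathrm{r}_\rho(g)$ be the vector space of natural transformations $1_V\Rightarrow\rho(g)$. For $\omega\in\hat G$ and $g'=\omega g^{\pi(\omega)}\omega^{-1}$ let $\beta_{g,\omega}:\mathbb{T}\mathrm{r}_\rho(g)\to\mathbb{T}\mathrm{r}_\rho(g')$ send $\phi$ to the composition $$1\Rightarrow\rho(\omega)\circ{}^{\pi(\omega)}\rho(\omega^{-1})\Rightarrow\rho(\omega)\circ{}^{\pi(\omega)}\rho(g^{\pi(\omega)})\circ{}^{\pi(\omega)}\rho(\omega^{-1})\Rightarrow\rho(g')\circ\rho(\omega)\circ{}^{\pi(\omega)}\rho(\omega^{-1})\Rightarrow\rho(g'),$$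 where the first and last arrows are induced by $(\psi_e\psi_{\omega,\omega^{-1}})^{\mp1}$, the third by $\psi_{g',\omega}^{-1}\psi_{\omega,g^{\pi(\omega)}}$, and the second by $\phi$ if $\pi(\omega)=1$ and by the opposite of $\rho(g^{-1})\xrightarrow{\rho(g^{-1})\phi}\rho(g^{-1})\rho(g)\xrightarrow{\psi_e\psi_{g^{-1},g}}1$ if $\pi(\omega)=-1$. If all spaces $\mathbb{T}\mathrm{r}_\rho(g)$ are finite dimensional, the Real $2$-character of $\rho$ is $\chi_\rho(g,\omega)=\operatorname{tr}(\beta_{g,\omega})$, defined for $g\in G$, $\omega\in\hat G$ with $\omega g^{\pi(\omega)}=g\omega$. **Transgression.** Put $$\tau_\pi^{\mathrm{ref}}(\hat\alpha)([\omega_2|\omega_1]\gamma)=\hat\alpha([\gamma|\gamma^{-1}|\gamma])^{\delta}\left(\frac{\hat\alpha([\omega_1\gamma^{-\pi(\omega_1)}\omega_1^{-1}|\omega_1\gamma^{\pi(\omega_1)}\omega_1^{-1}|\omega_1])\,\hat\alpha([\omega_1|\gamma^{-\pi(\omega_1)}|\gamma^{\pi(\omega_1)}])}{\hat\alpha([\omega_1\gamma^{-\pi(\omega_1)}\omega_1^{-1}|\omega_1|\gamma^{\pi(\omega_1)}])}\right)^{\frac{\pi(\omega_2)-1}{2}}\frac{\hat\alpha([\omega_2|\omega_1|\gamma^{\pi(\omega_2\omega_1)}])\,\hat\alpha([\omega_2\omega_1\gamma^{\pi(\omega_2\omega_1)}(\omega_2\omega_1)^{-1}|\omega_2|\omega_1])}{\hat\alpha([\omega_2|\omega_1\gamma^{\pi(\omega_2\omega_1)}\omega_1^{-1}|\omega_1])},$$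 where $\delta=1$ if $\pi(\omega_1)=\pi(\omega_2)=-1$ and $\delta=0$ otherwise, and, for $\omega g^{\pi(\omega)}=g\omega$ and $\sigma\in\hat G$, $$\tau\tau_\pi^{\mathrm{ref}}(\hat\alpha)([\sigma]g\xrightarrow{\omega}g)=\frac{\tau_\pi^{\mathrm{ref}}(\hat\alpha)([\sigma\omega\sigma^{-1}|\sigma]g)}{\tau_\pi^{\mathrm{ref}}(\hat\alpha)([\sigma|\omega]g)}.$$ **Real $2$-induction.** Let $\rho$ be a linear Real representation, on a $k$-linear category $V$, of the categorical group determined by $(\hat H,\hat\alpha|_{\hat H})$. Choose representatives $\sigma_1,\dots,\sigma_q$ of $\hat G/\hat H$. Then $\mathrm{RInd}(\rho)$ is the linear Real representation, for $(\hat G,\hat\alpha)$, on the category $\prod_{i=1}^q{}^{\pi(\sigma_i)}V$ in which $\omega\in\hat G$ acts by the matrix of functors whose $(j,i)$ entry is ${}^{\pi(\sigma_j)}\rho(\eta)$ if $\omega\sigma_i=\sigma_j\eta$ with $\eta\in\hat H$ and $0$ otherwise; its $2$-isomorphism $\psi_{\omega_2,\omega_1}$ has, for $\omega_1\sigma_i=\sigma_j\eta_1$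 and $\omega_2\sigma_j=\sigma_k\eta_2$ with $\eta_1,\eta_2\in\hat H$, the $(k,i)$ entry $$\frac{\hat\alpha([\omega_2|\sigma_j|\eta_1])}{\hat\alpha([\omega_2|\omega_1|\sigma_i])\,\hat\alpha([\sigma_k|\eta_2|\eta_1])}\cdot{}^{\pi(\sigma_k)}\psi^{\pi(\sigma_k)}_{\eta_2,\eta_1},$$ and its $\psi_e$ has the entries ${}^{\pi(\sigma_i)}\psi_e^{\pi(\sigma_i)}$. **Theorem.** Assume that $\mathbb{T}\mathrm{r}_\rho(h)$ is finite dimensional for all $h\in H$. Then the spaces $\mathbb{T}\mathrm{r}_{\mathrm{RInd}(\rho)}(g)$, $g\in G$, are finite dimensional, and for all $g\in G$ and $\omega\in\hat G$ with $\omega g^{\pi(\omega)}=g\omega$, $$\chi_{\mathrm{RInd}(\rho)}(g,\omega)=\frac{1}{2|H|}\sum_{\substack{\sigma\in\hat G\\ \sigma g^{\pi(\sigma)}\sigma^{-1},\;\sigma\omega\sigma^{-1}\in\hat H}}\tau\tau_\pi^{\mathrm{ref}}(\hat\alpha)([\sigma]g\xrightarrow{\omega}g)^{-1}\cdot\chi_\rho(\sigma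 g^{\pi(\sigma)}\sigma^{-1},\sigma\omega\sigma^{-1}).$$ -/

import Mathlib

open CategoryTheory

namespace Real2

universe v u

/-- The category `^ε C`: it is `C` for `ε = 1` and the opposite category for `ε = -1`.
Objects are those of `C`. -/
@[ext]
structure Signed (ε : ℤˣ) (C : Type u) : Type u where
  /-- the underlying object of `C` -/
  of : C

/-- Morphisms of `^ε C`. Exactly one of the two components has a true premise, so that a morphism
`x ⟶ y` of `^ε C` is a morphism `x ⟶ y` of `C` if `ε = 1` and a morphism `y ⟶ x` of `C` if
`ε = -1`. -/
@[ext]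
structure SignedHom {ε : ℤˣ} {C : Type u} [Category.{v} C] (x y : Signed ε C) : Type v where
  /-- the morphism if `ε = 1` -/
  pos : ε = 1 → (x.of ⟶ y.of)
  /-- the morphism if `ε = -1` -/
  neg : ε = -1 → (y.of ⟶ x.of)

namespace Signed

variable {γ δ ε : ℤˣ} {C : Type*} [Category* C] {D : Type*} [Category* D]

instance : Category (Signed ε C) where
  Hom x y := SignedHom x y
  id x := ⟨fun _ => 𝟙 x.of, fun _ => 𝟙 x.of⟩
  comp f g := ⟨fun h => f.pos h ≫ g.pos h, fun h => g.neg h ≫ f.neg h⟩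
  id_comp _ := by ext <;> simp
  comp_id _ := by ext <;> simp
  assoc _ _ _ := by ext <;> simp

@[ext] lemma hom_ext {x y : Signed ε C} {f g : x ⟶ y} (hp : ∀ h, f.pos h = g.pos h)
    (hn : ∀ h, f.neg h = g.neg h) : f = g :=
  SignedHom.ext (funext hp) (funext hn)

@[simp] lemma id_pos (x : Signed ε C) (h : ε = 1) : (𝟙 x : x ⟶ x).pos h = 𝟙 x.of := rfl
@[simp] lemma id_neg (x : Signed ε C) (h : ε = -1) : (𝟙 x : x ⟶ x).neg h = 𝟙 x.of := rfl
@[simp] lemma comp_pos {x y z : Signed ε C} (f : x ⟶ y) (g : y ⟶ z) (h : ε = 1) :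
    (f ≫ g).pos h = f.pos h ≫ g.pos h := rfl
@[simp] lemma comp_neg {x y z : Signed ε C} (f : x ⟶ y) (g : y ⟶ z) (h : ε = -1) :
    (f ≫ g).neg h = g.neg h ≫ f.neg h := rfl

section Linear

variable [Preadditive C]

instance (x y : Signed ε C) : Zero (x ⟶ y) := ⟨⟨fun _ => 0, fun _ => 0⟩⟩
instance (x y : Signed ε C) : Add (x ⟶ y) :=
  ⟨fun f g => ⟨fun h => f.pos h + g.pos h, fun h => f.neg h + g.neg h⟩⟩
instance (x y : Signed ε C) : Neg (x ⟶ y) := ⟨fun f => ⟨fun h => -f.pos h, fun h => -f.neg h⟩⟩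

@[simp] lemma hom_zero_pos {x y : Signed ε C} (h : ε = 1) : (0 : x ⟶ y).pos h = 0 := rfl
@[simp] lemma hom_zero_neg {x y : Signed ε C} (h : ε = -1) : (0 : x ⟶ y).neg h = 0 := rfl
@[simp] lemma hom_add_pos {x y : Signed ε C} (f g : x ⟶ y) (h : ε = 1) :
    (f + g).pos h = f.pos h + g.pos h := rfl
@[simp] lemma hom_add_neg {x y : Signed ε C} (f g : x ⟶ y) (h : ε = -1) :
    (f + g).neg h = f.neg h + g.neg h := rfl
@[simp] lemma hom_neg_pos {x y : Signed ε C} (f : x ⟶ y) (h : ε = 1) :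
    (-f).pos h = -f.pos h := rfl
@[simp] lemma hom_neg_neg {x y : Signed ε C} (f : x ⟶ y) (h : ε = -1) :
    (-f).neg h = -f.neg h := rfl

instance (x y : Signed ε C) : AddCommGroup (x ⟶ y) where
  add_assoc _ _ _ := by ext <;> simp [add_assoc]
  zero_add _ := by ext <;> simp
  add_zero _ := by ext <;> simp
  neg_add_cancel _ := by ext <;> simp
  add_comm _ _ := by ext <;> simp [add_comm]
  nsmul := nsmulRec
  zsmul := zsmulRec

instance : Preadditive (Signed ε C) where
  add_comp _ _ _ _ _ _ := by ext <;> simp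
  comp_add _ _ _ _ _ _ := by ext <;> simp

variable {R : Type*} [Semiring R] [Linear R C]

instance (x y : Signed ε C) : SMul R (x ⟶ y) :=
  ⟨fun r f => ⟨fun h => r • f.pos h, fun h => r • f.neg h⟩⟩

@[simp] lemma hom_smul_pos {x y : Signed ε C} (r : R) (f : x ⟶ y) (h : ε = 1) :
    (r • f).pos h = r • f.pos h := rfl
@[simp] lemma hom_smul_neg {x y : Signed ε C} (r : R) (f : x ⟶ y) (h : ε = -1) :
    (r • f).neg h = r • f.neg h := rfl

instance (x y : Signed ε C) : Module R (x ⟶ y) where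
  one_smul _ := by ext <;> simp
  mul_smul _ _ _ := by ext <;> simp [mul_smul]
  smul_zero _ := by ext <;> simp
  smul_add _ _ _ := by ext <;> simp
  add_smul _ _ _ := by ext <;> simp [add_smul]
  zero_smul _ := by ext <;> simp

instance : Linear R (Signed ε C) where
  smul_comp _ _ _ _ _ _ := by ext <;> simp
  comp_smul _ _ _ _ _ _ := by ext <;> simp

end Linear

/-- The isomorphism of `^ε C` from `x` to `y` induced by an isomorphism `e : x ≅ y` of `C`: it is
`e` if `ε = 1` and the inverse of `e`, read in the opposite category, if `ε = -1`. -/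
@[simps]
def iso (ε : ℤˣ) {x y : C} (e : x ≅ y) : (⟨x⟩ : Signed ε C) ≅ ⟨y⟩ where
  hom := ⟨fun _ => e.hom, fun _ => e.inv⟩
  inv := ⟨fun _ => e.inv, fun _ => e.hom⟩
  hom_inv_id := by ext <;> simp
  inv_hom_id := by ext <;> simp

/-- The identification `C = ^ε C` for `ε = 1`, on morphisms. -/
@[simps]
def ofOne (h : ε = 1) {x y : C} (f : x ⟶ y) : (⟨x⟩ : Signed ε C) ⟶ ⟨y⟩ where
  pos _ := f
  neg h' := absurd (h.symm.trans h') (by decide)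

lemma ofOne_id (h : ε = 1) (x : C) : ofOne h (𝟙 x) = 𝟙 _ := by
  ext h' <;> [rfl; exact absurd (h.symm.trans h') (by decide)]

lemma ofOne_comp (h : ε = 1) {x y z : C} (f : x ⟶ y) (g : y ⟶ z) :
    ofOne h (f ≫ g) = ofOne h f ≫ ofOne h g := by
  ext h' <;> [rfl; exact absurd (h.symm.trans h') (by decide)]

lemma ofOne_add [Preadditive C] (h : ε = 1) {x y : C} (f g : x ⟶ y) :
    ofOne h (f + g) = ofOne h f + ofOne h g := by
  ext h' <;> [rfl; exact absurd (h.symm.trans h') (by decide)]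

lemma ofOne_smul {R : Type*} [Semiring R] [Preadditive C] [Linear R C] (h : ε = 1) {x y : C}
    (r : R) (f : x ⟶ y) : ofOne h (r • f) = r • ofOne h f := by
  ext h' <;> [rfl; exact absurd (h.symm.trans h') (by decide)]

lemma mul_pp (h : γ = δ * ε) (h₁ : δ = 1) (h₂ : ε = 1) : γ = 1 := by
  subst h h₁ h₂; rfl
lemma mul_pn (h : γ = δ * ε) (h₁ : δ = 1) (h₂ : ε = -1) : γ = -1 := by
  subst h h₁ h₂; rfl
lemma mul_np (h : γ = δ * ε) (h₁ : δ = -1) (h₂ : ε = 1) : γ = -1 := by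
  subst h h₁ h₂; rfl
lemma mul_nn (h : γ = δ * ε) (h₁ : δ = -1) (h₂ : ε = -1) : γ = 1 := by
  subst h h₁ h₂; rfl

/-- The functor `^δ F : ^γ C = ^δ (^ε C) ⥤ ^δ D` induced by `F : ^ε C ⥤ D` for `γ = δ ε`, on
morphisms. -/
@[simps]
def push (F : Signed ε C ⥤ D) (h : γ = δ * ε) {x y : C} (f : (⟨x⟩ : Signed γ C) ⟶ ⟨y⟩) :
    (⟨F.obj ⟨x⟩⟩ : Signed δ D) ⟶ ⟨F.obj ⟨y⟩⟩ where
  pos h₁ := F.map (X := ⟨x⟩) (Y := ⟨y⟩)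
    ⟨fun h₂ => f.pos (mul_pp h h₁ h₂), fun h₂ => f.neg (mul_pn h h₁ h₂)⟩
  neg h₁ := F.map (X := ⟨y⟩) (Y := ⟨x⟩)
    ⟨fun h₂ => f.neg (mul_np h h₁ h₂), fun h₂ => f.pos (mul_nn h h₁ h₂)⟩

lemma push_id (F : Signed ε C ⥤ D) (h : γ = δ * ε) (x : C) :
    push F h (𝟙 (⟨x⟩ : Signed γ C)) = 𝟙 (⟨F.obj ⟨x⟩⟩ : Signed δ D) := by
  ext <;> exact F.map_id _

lemma push_comp (F : Signed ε C ⥤ D) (h : γ = δ * ε) {x y z : C}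
    (f : (⟨x⟩ : Signed γ C) ⟶ ⟨y⟩) (g : (⟨y⟩ : Signed γ C) ⟶ ⟨z⟩) :
    push F h (f ≫ g) = push F h f ≫ push F h g := by
  ext <;> refine Eq.trans ?_ (F.map_comp _ _) <;> rfl

lemma push_add [Preadditive C] [Preadditive D] (F : Signed ε C ⥤ D) [F.Additive]
    (h : γ = δ * ε) {x y : C} (f g : (⟨x⟩ : Signed γ C) ⟶ ⟨y⟩) :
    push F h (f + g) = push F h f + push F h g := by
  ext <;> refine Eq.trans ?_ F.map_add <;> rfl

lemma push_smul {R : Type*} [Semiring R] [Preadditive C] [Linear R C] [Preadditive D]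
    [Linear R D] (F : Signed ε C ⥤ D) [F.Linear R]
    (h : γ = δ * ε) {x y : C} (r : R) (f : (⟨x⟩ : Signed γ C) ⟶ ⟨y⟩) :
    push F h (r • f) = r • push F h f := by
  ext <;> refine Eq.trans ?_ (F.map_smul (R := R) _ _) <;> rfl

lemma push_iso (F : Signed ε C ⥤ D) (h : γ = δ * ε) {x y : C} (e : x ≅ y) :
    push F h (iso γ e).hom = (iso δ (F.mapIso (iso ε e))).hom := by
  ext <;> rfl

end Signed

section Scalars

variable {k : Type*} [CommRing k] {C : Type*} [Category* C] [Preadditive C] [Linear k C]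

/-- The isomorphism `c · e`. -/
@[simps]
def smulIso (c : kˣ) {x y : C} (e : x ≅ y) : x ≅ y where
  hom := (c : k) • e.hom
  inv := ((c⁻¹ : kˣ) : k) • e.inv
  hom_inv_id := by simp [smul_smul]
  inv_hom_id := by simp [smul_smul]

lemma iso_smulIso (ε : ℤˣ) (c : kˣ) {x y : C} (e : x ≅ y) :
    Signed.iso ε (smulIso c e) = smulIso (c ^ (ε : ℤ)) (Signed.iso ε e) := by
  ext h <;> simp [h]

end Scalars

section Rep

variable {G : Type*} [Group G]

/-- A normalized `3`-cocycle on `G` with coefficients in `kˣ`, on which `ω` acts by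
`a ↦ a ^ π(ω)`. -/
structure TwistedCocycle (π : G →* ℤˣ) (k : Type*) [CommRing k] where
  /-- the value on the simplex `[ω₃ | ω₂ | ω₁]` -/
  val : G → G → G → kˣ
  cocycle : ∀ ω₄ ω₃ ω₂ ω₁, val ω₃ ω₂ ω₁ ^ (π ω₄ : ℤ) * val ω₄ (ω₃ * ω₂) ω₁ * val ω₄ ω₃ ω₂ =
    val (ω₄ * ω₃) ω₂ ω₁ * val ω₄ ω₃ (ω₂ * ω₁)
  one_left : ∀ ω₂ ω₁, val 1 ω₂ ω₁ = 1
  one_mid : ∀ ω₂ ω₁, val ω₂ 1 ω₁ = 1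
  one_right : ∀ ω₂ ω₁, val ω₂ ω₁ 1 = 1

/-- The restriction of the grading to a subgroup. -/
abbrev resGrading (π : G →* ℤˣ) (H : Subgroup G) : H →* ℤˣ := π.comp H.subtype

/-- The restriction of a cocycle to a subgroup. -/
@[simps]
def TwistedCocycle.res {π : G →* ℤˣ} {k : Type*} [CommRing k] (α : TwistedCocycle π k)
    (H : Subgroup G) : TwistedCocycle (resGrading π H) k where
  val a b c := α.val a b c
  cocycle _ _ _ _ := α.cocycle _ _ _ _
  one_left _ _ := α.one_left _ _
  one_mid _ _ := α.one_mid _ _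
  one_right _ _ := α.one_right _ _

/-- The identity `F a x = F b y` for equal group elements `a`, `b` and equal objects `x`, `y`. -/
def castIso {π : G →* ℤˣ} {V : Type*} [Category* V] (F : ∀ ω : G, Signed (π ω) V ⥤ V)
    {a b : G} (h : a = b) {x y : V} (hxy : x = y) : (F a).obj ⟨x⟩ ≅ (F b).obj ⟨y⟩ :=
  eqToIso (by subst h hxy; rfl)

/-- An `α`-twisted Real `2`-representation on the `k`-linear category `V`, an object of the
`2`-category of `k`-linear categories with the duality involution `V ↦ Vᵒᵖ`.
Each `F ω` is an equivalence because of `ψ` and `ψe`. -/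
structure TwistedRep {π : G →* ℤˣ} {k : Type*} [CommRing k] (α : TwistedCocycle π k)
    (V : Type*) [Category* V] [Preadditive V] [Linear k V] where
  /-- the functors `ρ(ω) : ^π(ω) V ⥤ V` -/
  F : ∀ ω : G, Signed (π ω) V ⥤ V
  additive : ∀ ω, (F ω).Additive
  linear : ∀ ω, (F ω).Linear k
  /-- the components of the `2`-isomorphisms `ψ_{ω₂, ω₁} : ρ(ω₂) ∘ ^π(ω₂) ρ(ω₁) ≅ ρ(ω₂ ω₁)` -/
  ψ : ∀ (ω₂ ω₁ : G) (x : V), (F ω₂).obj ⟨(F ω₁).obj ⟨x⟩⟩ ≅ (F (ω₂ * ω₁)).obj ⟨x⟩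
  /-- the naturality of `ψ_{ω₂, ω₁}` -/
  ψ_nat : ∀ (ω₂ ω₁ : G) {x y : V} (f : (⟨x⟩ : Signed (π (ω₂ * ω₁)) V) ⟶ ⟨y⟩),
    (F ω₂).map (Signed.push (F ω₁) (π.map_mul ω₂ ω₁) f) ≫ (ψ ω₂ ω₁ y).hom =
      (ψ ω₂ ω₁ x).hom ≫ (F (ω₂ * ω₁)).map f
  /-- the components of the `2`-isomorphism `ψ_e : ρ(e) ≅ 1_V` -/
  ψe : ∀ x : V, (F 1).obj ⟨x⟩ ≅ x
  /-- the naturality of `ψ_e` -/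
  ψe_nat : ∀ {x y : V} (f : x ⟶ y),
    (F 1).map (Signed.ofOne π.map_one f) ≫ (ψe y).hom = (ψe x).hom ≫ f
  /-- twisted associativity:
  `α([ω₃|ω₂|ω₁]) · ψ_{ω₃ω₂,ω₁} (ψ_{ω₃,ω₂} ∘ ρ(ω₁)) = ψ_{ω₃,ω₂ω₁} (ρ(ω₃) ∘ ψ_{ω₂,ω₁} ^ π(ω₃))` -/
  assoc : ∀ (ω₃ ω₂ ω₁ : G) (x : V),
    smulIso (α.val ω₃ ω₂ ω₁) (ψ ω₃ ω₂ ((F ω₁).obj ⟨x⟩) ≪≫ ψ (ω₃ * ω₂) ω₁ x) ≪≫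
        castIso F (mul_assoc ω₃ ω₂ ω₁) rfl =
      (F ω₃).mapIso (Signed.iso (π ω₃) (ψ ω₂ ω₁ x)) ≪≫ ψ ω₃ (ω₂ * ω₁) x
  /-- `ψ_{e,ω} = ψ_e ∘ ρ(ω)` -/
  unit_left : ∀ (ω : G) (x : V),
    ψ 1 ω x ≪≫ castIso F (one_mul ω) rfl = ψe ((F ω).obj ⟨x⟩)
  /-- `ψ_{ω,e} = ρ(ω) ∘ ψ_e ^ π(ω)` -/
  unit_right : ∀ (ω : G) (x : V),
    ψ ω 1 x ≪≫ castIso F (mul_one ω) rfl = (F ω).mapIso (Signed.iso (π ω) (ψe x))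

namespace TwistedRep

variable {π : G →* ℤˣ} {k : Type*} [CommRing k] {α : TwistedCocycle π k}
  {V : Type*} [Category* V] [Preadditive V] [Linear k V] (ρ : TwistedRep α V)

instance (ω : G) : (ρ.F ω).Additive := ρ.additive ω
instance (ω : G) : (ρ.F ω).Linear k := ρ.linear ω

/-- The endofunctor `ρ(g)` of `V` for an element `g` of degree `+1`, on morphisms. -/
def actMap (g : π.ker) {x y : V} (f : x ⟶ y) : (ρ.F g).obj ⟨x⟩ ⟶ (ρ.F g).obj ⟨y⟩ :=
  (ρ.F g).map (Signed.ofOne (MonoidHom.mem_ker.mp g.2) f)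

lemma actMap_comp (g : π.ker) {x y z : V} (f : x ⟶ y) (f' : y ⟶ z) :
    ρ.actMap g (f ≫ f') = ρ.actMap g f ≫ ρ.actMap g f' := by
  rw [actMap, Signed.ofOne_comp]; exact (ρ.F _).map_comp _ _

lemma actMap_add (g : π.ker) {x y : V} (f f' : x ⟶ y) :
    ρ.actMap g (f + f') = ρ.actMap g f + ρ.actMap g f' := by
  rw [actMap, Signed.ofOne_add]; exact (ρ.F _).map_add

lemma actMap_smul (g : π.ker) {x y : V} (c : k) (f : x ⟶ y) :
    ρ.actMap g (c • f) = c • ρ.actMap g f := by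
  rw [actMap, Signed.ofOne_smul]; exact (ρ.F _).map_smul _ _

/-- The endofunctor `ρ(g)` of `V` for an element `g` of degree `+1`. -/
@[simps]
def act (g : π.ker) : V ⥤ V where
  obj x := (ρ.F g).obj ⟨x⟩
  map f := ρ.actMap g f
  map_id _ := by rw [actMap, Signed.ofOne_id]; exact (ρ.F _).map_id _
  map_comp f f' := ρ.actMap_comp g f f'

/-- The categorical trace `Tr_ρ(g)`, the space of natural transformations from `1_V` to `ρ(g)`. -/
abbrev Tr (g : π.ker) := 𝟭 V ⟶ ρ.act g

/-- The value at `x` of an element of the categorical trace. -/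
def ev {g : π.ker} (φ : ρ.Tr g) (x : V) : x ⟶ (ρ.F g).obj ⟨x⟩ := φ.app x

lemma ev_naturality {g : π.ker} (φ : ρ.Tr g) {x y : V} (f : x ⟶ y) :
    f ≫ ρ.ev φ y = ρ.ev φ x ≫ ρ.actMap g f := φ.naturality f

/-- For `a b = 1`, the isomorphism `ψ_e ψ_{a,b}` from `ρ(a) ∘ ^π(a) ρ(b)` to the identity,
at the object `x`. -/
def cap {a b : G} (h : a * b = 1) (x : V) : (ρ.F a).obj ⟨(ρ.F b).obj ⟨x⟩⟩ ≅ x :=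
  ρ.ψ a b x ≪≫ castIso ρ.F h rfl ≪≫ ρ.ψe x

lemma castIso_naturality {a b : G} (h : a = b) {x y : V}
    (f : (⟨x⟩ : Signed (π a) V) ⟶ ⟨y⟩) (f' : (⟨x⟩ : Signed (π b) V) ⟶ ⟨y⟩)
    (hp : ∀ h h', f.pos h = f'.pos h') (hn : ∀ h h', f.neg h = f'.neg h') :
    (ρ.F a).map f ≫ (castIso ρ.F h rfl).hom = (castIso ρ.F h rfl).hom ≫ (ρ.F b).map f' := by
  subst h
  obtain rfl : f = f' := by ext h <;> [exact hp h h; exact hn h h]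
  simp [castIso]

lemma cap_naturality {a b : G} (h : a * b = 1) {x y : V} (f : x ⟶ y) :
    (ρ.F a).map (Signed.push (ρ.F b) (π.map_mul a b) (Signed.ofOne (by rw [h, π.map_one]) f)) ≫
      (ρ.cap h y).hom = (ρ.cap h x).hom ≫ f := by
  have h1 := ρ.ψ_nat a b (Signed.ofOne (by rw [h, π.map_one]) f)
  have h2 := ρ.ψe_nat f
  have h3 := ρ.castIso_naturality h (Signed.ofOne (by rw [h, π.map_one]) f)
    (Signed.ofOne π.map_one f) (fun _ _ => rfl)
    (fun h' h'' => absurd ((π.map_one).symm.trans h'') (by decide))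
  simp only [cap, Iso.trans_hom, Category.assoc]
  rw [reassoc_of% h1, reassoc_of% h3, h2]

/-- The value at `x` of the `2`-morphism `1 ⟶ ^π(ω) ρ(g ^ π(ω))` of `^π(ω) V` induced by
`φ : 1 ⟶ ρ(g)`. It is `φ` if `π(ω) = 1`. If `π(ω) = -1`, it is the transformation
`ρ(g⁻¹) ⟶ ρ(g⁻¹) ρ(g) ⟶ 1` of endofunctors of `V`, composed of `ρ(g⁻¹) φ` and `ψ_e ψ_{g⁻¹,g}`,
read in the opposite category. -/
def twist (ω : G) {g : π.ker} (φ : ρ.Tr g) (x : V) :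
    (⟨x⟩ : Signed (π ω) V) ⟶ ⟨(ρ.F ↑(g ^ (π ω : ℤ))).obj ⟨x⟩⟩ where
  pos h := ρ.ev φ x ≫ (castIso ρ.F (a := ↑g) (by simp [h]) rfl).hom
  neg h := (castIso ρ.F (b := ↑(g⁻¹)) (by simp [h]) rfl).hom ≫ ρ.actMap g⁻¹ (ρ.ev φ x) ≫
    (ρ.cap (a := ↑(g⁻¹)) (b := ↑g) (by simp) x).hom

/-- For `ω g ^ π(ω) = g' ω`, the composition
`ρ(ω) ⟶ ρ(ω) ∘ ^π(ω) ρ(g ^ π(ω)) ⟶ ρ(ω g ^ π(ω)) = ρ(g' ω) ⟶ ρ(g') ∘ ρ(ω)` at `y`. -/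
def slide {ω : G} {g g' : π.ker} (h : ω * ↑(g ^ (π ω : ℤ)) = ↑g' * ω) (φ : ρ.Tr g) (y : V) :
    (ρ.F ω).obj ⟨y⟩ ⟶ (ρ.F g').obj ⟨(ρ.F ω).obj ⟨y⟩⟩ :=
  (ρ.F ω).map (ρ.twist ω φ y) ≫ (ρ.ψ ω ↑(g ^ (π ω : ℤ)) y).hom ≫
    (castIso ρ.F h rfl).hom ≫ (ρ.ψ g' ω y).inv

lemma sign_coe (ω : G) (g : π.ker) : π ω = π ω * π (g : G) := by
  rw [MonoidHom.mem_ker.mp g.2, mul_one]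

lemma ker_ne (g : π.ker) : π (g : G) ≠ -1 := fun h =>
  absurd ((MonoidHom.mem_ker.mp g.2).symm.trans h) (by decide)

lemma push_ker {ε δ : ℤˣ} (g : π.ker) (h : ε = δ * π (g : G)) {x y : V}
    (f : (⟨x⟩ : Signed ε V) ⟶ ⟨y⟩) :
    Signed.push (ρ.F g) h f =
      ⟨fun h' => ρ.actMap g (f.pos (by rw [h, h', MonoidHom.mem_ker.mp g.2]; rfl)),
        fun h' => ρ.actMap g (f.neg (by rw [h, h', MonoidHom.mem_ker.mp g.2]; rfl))⟩ := by
  ext h'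
  · refine congrArg (ρ.F g).map ?_
    ext h'' <;> [rfl; exact absurd h'' (ker_ne _)]
  · refine congrArg (ρ.F g).map ?_
    ext h'' <;> [rfl; exact absurd h'' (ker_ne _)]

lemma castIso_actMap {g g' : π.ker} (h : (g : G) = g') {x y : V} (f : x ⟶ y) :
    ρ.actMap g f ≫ (castIso ρ.F h rfl).hom = (castIso ρ.F h rfl).hom ≫ ρ.actMap g' f :=
  ρ.castIso_naturality h _ _ (fun _ _ => rfl) (fun h' _ => absurd h' (ker_ne _))

lemma twist_naturality (ω : G) {g : π.ker} (φ : ρ.Tr g) {x y : V}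
    (f : (⟨x⟩ : Signed (π ω) V) ⟶ ⟨y⟩) :
    f ≫ ρ.twist ω φ y = ρ.twist ω φ x ≫
      Signed.push (ρ.F ↑(g ^ (π ω : ℤ))) (sign_coe ω (g ^ (π ω : ℤ))) f := by
  rw [push_ker]
  ext h
  · have h1 := ρ.ev_naturality φ (f.pos h)
    have h3 := ρ.castIso_actMap (g := g) (g' := g ^ (π ω : ℤ)) (by simp [h]) (f.pos h)
    simp only [twist, Signed.comp_pos, Category.assoc]
    rw [reassoc_of% h1, h3]
  · have h1 := ρ.ev_naturality φ (f.neg h)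
    have h3 := ρ.castIso_actMap (g := g ^ (π ω : ℤ)) (g' := g⁻¹) (by simp [h]) (f.neg h)
    have h4 := ρ.cap_naturality (a := ↑(g⁻¹)) (b := ↑g) (by simp) (f.neg h)
    have h6 : (ρ.F ↑(g⁻¹)).map (Signed.push (ρ.F ↑g) (π.map_mul _ _)
          (Signed.ofOne (by simp) (f.neg h))) = ρ.actMap g⁻¹ (ρ.actMap g (f.neg h)) := by
      rw [push_ker]
      refine congrArg (ρ.F ↑(g⁻¹)).map ?_
      ext h' <;> [rfl; exact absurd h' (ker_ne _)]
    rw [h6] at h4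
    have h5 : ρ.actMap g⁻¹ (f.neg h) ≫ ρ.actMap g⁻¹ (ρ.ev φ x) =
        ρ.actMap g⁻¹ (ρ.ev φ y) ≫ ρ.actMap g⁻¹ (ρ.actMap g (f.neg h)) := by
      rw [← actMap_comp, ← actMap_comp, h1]
    simp only [twist, Signed.comp_neg, Category.assoc]
    rw [reassoc_of% h3, reassoc_of% h5, h4]

lemma slide_naturality {ω : G} {g g' : π.ker} (h : ω * ↑(g ^ (π ω : ℤ)) = ↑g' * ω)
    (φ : ρ.Tr g) {x y : V} (f : (⟨x⟩ : Signed (π ω) V) ⟶ ⟨y⟩) :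
    (ρ.F ω).map f ≫ ρ.slide h φ y = ρ.slide h φ x ≫ ρ.actMap g' ((ρ.F ω).map f) := by
  have e1 : π (ω * ↑(g ^ (π ω : ℤ))) = π ω := by
    rw [map_mul, MonoidHom.mem_ker.mp (g ^ (π ω : ℤ)).2, mul_one]
  have e2 : π (↑g' * ω) = π ω := by rw [← h, e1]
  have h1 := congrArg (ρ.F ω).map (ρ.twist_naturality ω φ f)
  rw [Functor.map_comp, Functor.map_comp] at h1
  let f1 : (⟨x⟩ : Signed (π (ω * ↑(g ^ (π ω : ℤ)))) V) ⟶ ⟨y⟩ :=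
    ⟨fun h => f.pos (e1.symm.trans h), fun h => f.neg (e1.symm.trans h)⟩
  let f2 : (⟨x⟩ : Signed (π (↑g' * ω)) V) ⟶ ⟨y⟩ :=
    ⟨fun h => f.pos (e2.symm.trans h), fun h => f.neg (e2.symm.trans h)⟩
  have h2 := ρ.ψ_nat ω ↑(g ^ (π ω : ℤ)) f1
  have h3 := ρ.castIso_naturality h f1 f2 (fun _ _ => rfl) (fun _ _ => rfl)
  have h4 := ρ.ψ_nat ↑g' ω f2
  have h4' : (ρ.F (↑g' * ω)).map f2 ≫ (ρ.ψ g' ω y).inv = (ρ.ψ g' ω x).inv ≫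
      (ρ.F g').map (Signed.push (ρ.F ω) (π.map_mul _ _) f2) := by
    rw [Iso.comp_inv_eq, Category.assoc, h4, Iso.inv_hom_id_assoc]
  have h5 : ρ.actMap g' ((ρ.F ω).map f) =
      (ρ.F g').map (Signed.push (ρ.F ω) (π.map_mul _ _) f2) := by
    refine congrArg (ρ.F g').map ?_
    ext h'
    · rfl
    · exact absurd ((MonoidHom.mem_ker.mp g'.2).symm.trans h') (by decide)
  have h6 : (ρ.F ω).map (Signed.push (ρ.F ↑(g ^ (π ω : ℤ))) (sign_coe ω (g ^ (π ω : ℤ))) f) =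
      (ρ.F ω).map (Signed.push (ρ.F ↑(g ^ (π ω : ℤ))) (π.map_mul _ _) f1) := rfl
  rw [h5]
  unfold slide
  rw [reassoc_of% h1, h6, reassoc_of% h2, reassoc_of% h3, h4']
  simp

lemma ev_add {g : π.ker} (φ φ' : ρ.Tr g) (x : V) :
    ρ.ev (φ + φ') x = ρ.ev φ x + ρ.ev φ' x := rfl

lemma ev_smul {g : π.ker} (c : k) (φ : ρ.Tr g) (x : V) : ρ.ev (c • φ) x = c • ρ.ev φ x := rfl

lemma twist_add (ω : G) {g : π.ker} (φ φ' : ρ.Tr g) (x : V) :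
    ρ.twist ω (φ + φ') x = ρ.twist ω φ x + ρ.twist ω φ' x := by
  ext h <;> simp [twist, ev_add, actMap_add]

lemma twist_smul (ω : G) {g : π.ker} (c : k) (φ : ρ.Tr g) (x : V) :
    ρ.twist ω (c • φ) x = c • ρ.twist ω φ x := by
  ext h <;> simp [twist, ev_smul, actMap_smul]

lemma slide_add {ω : G} {g g' : π.ker} (h : ω * ↑(g ^ (π ω : ℤ)) = ↑g' * ω) (φ φ' : ρ.Tr g)
    (y : V) : ρ.slide h (φ + φ') y = ρ.slide h φ y + ρ.slide h φ' y := by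
  simp only [slide, twist_add, Functor.map_add, Preadditive.add_comp]

lemma slide_smul {ω : G} {g g' : π.ker} (h : ω * ↑(g ^ (π ω : ℤ)) = ↑g' * ω) (c : k)
    (φ : ρ.Tr g) (y : V) : ρ.slide h (c • φ) y = c • ρ.slide h φ y := by
  simp only [slide, twist_smul, Functor.map_smul, Linear.smul_comp]

lemma beta_naturality {ω : G} {g g' : π.ker} (h : ω * ↑(g ^ (π ω : ℤ)) = ↑g' * ω)
    (φ : ρ.Tr g) {x y : V} (f : x ⟶ y) :
    f ≫ (ρ.cap (mul_inv_cancel ω) y).inv ≫ ρ.slide h φ ((ρ.F ω⁻¹).obj ⟨y⟩) ≫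
        ρ.actMap g' (ρ.cap (mul_inv_cancel ω) y).hom =
      ((ρ.cap (mul_inv_cancel ω) x).inv ≫ ρ.slide h φ ((ρ.F ω⁻¹).obj ⟨x⟩) ≫
        ρ.actMap g' (ρ.cap (mul_inv_cancel ω) x).hom) ≫ ρ.actMap g' f := by
  have h1 := ρ.cap_naturality (mul_inv_cancel ω) f
  have h2 := ρ.slide_naturality h φ (Signed.push (ρ.F ω⁻¹) (π.map_mul ω ω⁻¹)
    (Signed.ofOne (by rw [mul_inv_cancel, π.map_one]) f))
  have h3 : f ≫ (ρ.cap (mul_inv_cancel ω) y).inv = (ρ.cap (mul_inv_cancel ω) x).inv ≫ _ :=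
    (Iso.comp_inv_eq _).mpr (((Iso.inv_comp_eq _).mpr h1).symm.trans
      (Category.assoc _ _ _).symm)
  rw [reassoc_of% h3, reassoc_of% h2, ← actMap_comp, h1, actMap_comp]
  simp only [Category.assoc]

/-- For `ω g ^ π(ω) = g' ω` and `φ : 1 ⟶ ρ(g)`, the value at `x` of the composition
`1 ⟶ ρ(ω) ∘ ^π(ω) ρ(ω⁻¹) ⟶ ρ(g') ∘ ρ(ω) ∘ ^π(ω) ρ(ω⁻¹) ⟶ ρ(g')`. -/
def betaApp {ω : G} {g g' : π.ker} (h : ω * ↑(g ^ (π ω : ℤ)) = ↑g' * ω) (φ : ρ.Tr g) (x : V) :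
    x ⟶ (ρ.F g').obj ⟨x⟩ :=
  (ρ.cap (mul_inv_cancel ω) x).inv ≫ ρ.slide h φ ((ρ.F ω⁻¹).obj ⟨x⟩) ≫
    ρ.actMap g' (ρ.cap (mul_inv_cancel ω) x).hom

lemma betaApp_naturality {ω : G} {g g' : π.ker} (h : ω * ↑(g ^ (π ω : ℤ)) = ↑g' * ω)
    (φ : ρ.Tr g) {x y : V} (f : x ⟶ y) :
    f ≫ ρ.betaApp h φ y = ρ.betaApp h φ x ≫ ρ.actMap g' f := by
  have h1 := ρ.cap_naturality (mul_inv_cancel ω) f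
  have h2 := ρ.slide_naturality h φ (Signed.push (ρ.F ω⁻¹) (π.map_mul ω ω⁻¹)
    (Signed.ofOne (by rw [mul_inv_cancel, π.map_one]) f))
  have h3 : f ≫ (ρ.cap (mul_inv_cancel ω) y).inv = (ρ.cap (mul_inv_cancel ω) x).inv ≫ _ :=
    (Iso.comp_inv_eq _).mpr (((Iso.inv_comp_eq _).mpr h1).symm.trans
      (Category.assoc _ _ _).symm)
  simp only [betaApp, Category.assoc]
  rw [reassoc_of% h3, reassoc_of% h2, ← actMap_comp, h1, actMap_comp]

lemma betaApp_add {ω : G} {g g' : π.ker} (h : ω * ↑(g ^ (π ω : ℤ)) = ↑g' * ω)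
    (φ φ' : ρ.Tr g) (x : V) :
    ρ.betaApp h (φ + φ') x = ρ.betaApp h φ x + ρ.betaApp h φ' x := by
  simp only [betaApp, slide_add, Preadditive.add_comp, Preadditive.comp_add]

lemma betaApp_smul {ω : G} {g g' : π.ker} (h : ω * ↑(g ^ (π ω : ℤ)) = ↑g' * ω)
    (c : k) (φ : ρ.Tr g) (x : V) : ρ.betaApp h (c • φ) x = c • ρ.betaApp h φ x := by
  simp only [betaApp, slide_smul, Linear.smul_comp, Linear.comp_smul]

/-- For `ω g ^ π(ω) = g' ω`, that is, `g' = ω g ^ π(ω) ω⁻¹`, the linear map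
`β_{g, ω} : Tr_ρ(g) ⟶ Tr_ρ(g')`. -/
def beta {ω : G} {g g' : π.ker} (h : ω * ↑(g ^ (π ω : ℤ)) = ↑g' * ω) :
    ρ.Tr g →ₗ[k] ρ.Tr g' where
  toFun φ := { app := ρ.betaApp h φ, naturality := fun _ _ f => ρ.betaApp_naturality h φ f }
  map_add' φ φ' := by ext x; exact ρ.betaApp_add h φ φ' x
  map_smul' c φ := by ext x; exact ρ.betaApp_smul h c φ x

end TwistedRep

/-- A graded commuting pair `(g, ω)`: `g` has degree `+1` and `ω g ^ π(ω) = g ω`. -/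
structure GComm (π : G →* ℤˣ) where
  /-- the element of degree `+1` -/
  g : π.ker
  /-- the element of arbitrary degree -/
  ω : G
  comm : ω * ↑(g ^ (π ω : ℤ)) = ↑g * ω

namespace GComm

variable {π : G →* ℤˣ}

/-- The pair `(σ g ^ π(σ) σ⁻¹, σ ω σ⁻¹)`. -/
def conj (p : GComm π) (σ : G) : GComm π where
  g := ⟨σ * ↑(p.g ^ (π σ : ℤ)) * σ⁻¹, by
    rw [MonoidHom.mem_ker, map_mul, map_mul, MonoidHom.mem_ker.mp (p.g ^ (π σ : ℤ)).2, mul_one,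
      map_inv, mul_inv_cancel]⟩
  ω := σ * p.ω * σ⁻¹
  comm := by
    have h := p.comm
    have hπ : π (σ * p.ω * σ⁻¹) = π p.ω := by
      rw [map_mul, map_mul, map_inv, mul_right_comm, mul_inv_cancel, one_mul]
    rw [hπ]
    push_cast at h ⊢
    have h' := SemiconjBy.zpow_right (a := p.ω) h (π σ : ℤ)
    rw [conj_zpow, ← zpow_mul, mul_comm, zpow_mul]
    calc _ = σ * (p.ω * ((p.g : G) ^ (π p.ω : ℤ)) ^ (π σ : ℤ)) * σ⁻¹ := by group
      _ = σ * ((p.g : G) ^ (π σ : ℤ) * p.ω) * σ⁻¹ := by rw [h'.eq]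
      _ = _ := by group

/-- The pair lies in the subgroup `H`. -/
def Mem (p : GComm π) (H : Subgroup G) : Prop := (p.g : G) ∈ H ∧ p.ω ∈ H

/-- A graded commuting pair of elements of `H`, as a graded commuting pair of the graded group
`H`. -/
def toSub (p : GComm π) {H : Subgroup G} (h : p.Mem H) : GComm (resGrading π H) where
  g := ⟨⟨p.g, h.1⟩, p.g.2⟩
  ω := ⟨p.ω, h.2⟩
  comm := by
    apply Subtype.ext
    have := p.comm
    push_cast at this ⊢
    exact this

end GComm

/-- The Real `2`-character `χ_ρ(g, ω)`, the trace of `β_{g, ω}` on `Tr_ρ(g)`. -/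
noncomputable def TwistedRep.chi {π : G →* ℤˣ} {k : Type*} [CommRing k] {α : TwistedCocycle π k}
    {V : Type*} [Category* V] [Preadditive V] [Linear k V] (ρ : TwistedRep α V) (p : GComm π) :
    k :=
  LinearMap.trace k (ρ.Tr p.g) (ρ.beta p.comm)

namespace TwistedCocycle

variable {π : G →* ℤˣ} {k : Type*} [CommRing k] (α : TwistedCocycle π k)

/-- The loop transgression of `α`, evaluated on `[ω₂ | ω₁] γ`. -/
def tauRef (ω₂ ω₁ γ : G) : kˣ :=
  (if π ω₂ = -1 ∧ π ω₁ = -1 then α.val γ γ⁻¹ γ else 1) *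
  (α.val (ω₁ * γ ^ (-π ω₁ : ℤ) * ω₁⁻¹) (ω₁ * γ ^ (π ω₁ : ℤ) * ω₁⁻¹) ω₁ *
      α.val ω₁ (γ ^ (-π ω₁ : ℤ)) (γ ^ (π ω₁ : ℤ)) /
      α.val (ω₁ * γ ^ (-π ω₁ : ℤ) * ω₁⁻¹) ω₁ (γ ^ (π ω₁ : ℤ))) ^ (((π ω₂ : ℤ) - 1) / 2) *
  (α.val ω₂ ω₁ (γ ^ (π (ω₂ * ω₁) : ℤ)) *
      α.val (ω₂ * ω₁ * γ ^ (π (ω₂ * ω₁) : ℤ) * (ω₂ * ω₁)⁻¹) ω₂ ω₁ /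
      α.val ω₂ (ω₁ * γ ^ (π (ω₂ * ω₁) : ℤ) * ω₁⁻¹) ω₁)

/-- The iterated transgression of `α`, evaluated on `[σ] (g ⟶ g)` for the loop given by `ω`. -/
def tautau (σ : G) (p : GComm π) : kˣ :=
  α.tauRef (σ * p.ω * σ⁻¹) σ p.g / α.tauRef σ p.ω p.g

end TwistedCocycle
end Rep

/-- The product category `∏ i, ^(ε i) V`. An object is a family of objects of `V`. -/
@[ext]
structure SProd {ι : Type*} (ε : ι → ℤˣ) (V : Type*) where
  /-- the underlying family of objects -/
  of : ι → V

/-- Morphisms of `∏ i, ^(ε i) V`: families of morphisms of the categories `^(ε i) V`. -/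
@[ext]
structure SProdHom {ι : Type*} {ε : ι → ℤˣ} {V : Type*} [Category* V] (x y : SProd ε V) where
  /-- the components -/
  app : ∀ i, (⟨x.of i⟩ : Signed (ε i) V) ⟶ ⟨y.of i⟩

namespace SProd

variable {ι : Type*} {ε : ι → ℤˣ} {V : Type*} [Category* V]

instance : Category (SProd ε V) where
  Hom x y := SProdHom x y
  id x := ⟨fun _ => 𝟙 _⟩
  comp f g := ⟨fun i => f.app i ≫ g.app i⟩
  id_comp _ := by ext : 2; exact Category.id_comp _
  comp_id _ := by ext : 2; exact Category.comp_id _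
  assoc _ _ _ := by ext : 2; exact Category.assoc _ _ _

lemma hom_ext {x y : SProd ε V} {f g : x ⟶ y} (h : ∀ i, f.app i = g.app i) : f = g :=
  SProdHom.ext (funext h)

@[simp] lemma id_at (x : SProd ε V) (i : ι) : (𝟙 x : x ⟶ x).app i = 𝟙 _ := rfl
@[simp] lemma comp_at {x y z : SProd ε V} (f : x ⟶ y) (g : y ⟶ z) (i : ι) :
    (f ≫ g).app i = f.app i ≫ g.app i := rfl

/-- The isomorphism of the product category with given components. -/
@[simps]
def iso {x y : SProd ε V} (e : ∀ i, (⟨x.of i⟩ : Signed (ε i) V) ≅ ⟨y.of i⟩) : x ≅ y where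
  hom := ⟨fun i => (e i).hom⟩
  inv := ⟨fun i => (e i).inv⟩
  hom_inv_id := hom_ext fun i => (e i).hom_inv_id
  inv_hom_id := hom_ext fun i => (e i).inv_hom_id

section Linear

variable [Preadditive V]

instance (x y : SProd ε V) : Zero (x ⟶ y) := ⟨⟨fun _ => 0⟩⟩
instance (x y : SProd ε V) : Add (x ⟶ y) := ⟨fun f g => ⟨fun i => f.app i + g.app i⟩⟩
instance (x y : SProd ε V) : Neg (x ⟶ y) := ⟨fun f => ⟨fun i => -f.app i⟩⟩

@[simp] lemma hom_zero_at {x y : SProd ε V} (i : ι) : (0 : x ⟶ y).app i = 0 := rfl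
@[simp] lemma hom_add_at {x y : SProd ε V} (f g : x ⟶ y) (i : ι) :
    (f + g).app i = f.app i + g.app i := rfl
@[simp] lemma hom_neg_at {x y : SProd ε V} (f : x ⟶ y) (i : ι) : (-f).app i = -f.app i := rfl

instance (x y : SProd ε V) : AddCommGroup (x ⟶ y) where
  add_assoc _ _ _ := hom_ext fun _ => add_assoc _ _ _
  zero_add _ := hom_ext fun _ => zero_add _
  add_zero _ := hom_ext fun _ => add_zero _
  neg_add_cancel _ := hom_ext fun _ => neg_add_cancel _
  add_comm _ _ := hom_ext fun _ => add_comm _ _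
  nsmul := nsmulRec
  zsmul := zsmulRec

instance : Preadditive (SProd ε V) where
  add_comp _ _ _ _ _ _ := hom_ext fun _ => Preadditive.add_comp _ _ _ _ _ _
  comp_add _ _ _ _ _ _ := hom_ext fun _ => Preadditive.comp_add _ _ _ _ _ _

variable {R : Type*} [Semiring R] [Linear R V]

instance (x y : SProd ε V) : SMul R (x ⟶ y) := ⟨fun r f => ⟨fun i => r • f.app i⟩⟩

@[simp] lemma hom_smul_at {x y : SProd ε V} (r : R) (f : x ⟶ y) (i : ι) :
    (r • f).app i = r • f.app i := rfl

instance (x y : SProd ε V) : Module R (x ⟶ y) where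
  one_smul _ := hom_ext fun _ => one_smul _ _
  mul_smul _ _ _ := hom_ext fun _ => mul_smul _ _ _
  smul_zero _ := hom_ext fun _ => smul_zero _
  smul_add _ _ _ := hom_ext fun _ => smul_add _ _ _
  add_smul _ _ _ := hom_ext fun _ => add_smul _ _ _
  zero_smul _ := hom_ext fun _ => zero_smul _ _

instance : Linear R (SProd ε V) where
  smul_comp _ _ _ _ _ _ := hom_ext fun _ => Linear.smul_comp _ _ _ _ _ _
  comp_smul _ _ _ _ _ _ := hom_ext fun _ => Linear.comp_smul _ _ _ _ _ _

end Linear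

/-- The projection `^δ (∏ i, ^(ε i) V) ⥤ ^δ (^(ε i) V) = ^γ V` for `γ = δ (ε i)`, on
morphisms. -/
def coord {γ δ : ℤˣ} {x y : SProd ε V} (f : (⟨x⟩ : Signed δ (SProd ε V)) ⟶ ⟨y⟩) (i : ι)
    (h : γ = δ * ε i) : (⟨x.of i⟩ : Signed γ V) ⟶ ⟨y.of i⟩ :=
  if h₁ : δ = 1 then
    ⟨fun hγ => ((f.pos h₁).app i).pos (by rw [h, h₁, one_mul] at hγ; exact hγ),
      fun hγ => ((f.pos h₁).app i).neg (by rw [h, h₁, one_mul] at hγ; exact hγ)⟩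
  else
    have h₂ : δ = -1 := (Int.units_eq_one_or δ).resolve_left h₁
    ⟨fun hγ => ((f.neg h₂).app i).neg (by
        rw [h, h₂, neg_one_mul, neg_eq_iff_eq_neg] at hγ; exact hγ),
      fun hγ => ((f.neg h₂).app i).pos (by rw [h, h₂, neg_one_mul, neg_inj] at hγ; exact hγ)⟩

lemma coord_pos {γ δ : ℤˣ} {x y : SProd ε V} (f : (⟨x⟩ : Signed δ (SProd ε V)) ⟶ ⟨y⟩) (i : ι)
    (h : γ = δ * ε i) (h₁ : δ = 1) : coord f i h =
    ⟨fun hγ => ((f.pos h₁).app i).pos (by rw [h, h₁, one_mul] at hγ; exact hγ),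
      fun hγ => ((f.pos h₁).app i).neg (by rw [h, h₁, one_mul] at hγ; exact hγ)⟩ :=
  dif_pos h₁

lemma coord_neg {γ δ : ℤˣ} {x y : SProd ε V} (f : (⟨x⟩ : Signed δ (SProd ε V)) ⟶ ⟨y⟩) (i : ι)
    (h : γ = δ * ε i) (h₁ : δ = -1) : coord f i h =
    ⟨fun hγ => ((f.neg h₁).app i).neg (by
        rw [h, h₁, neg_one_mul, neg_eq_iff_eq_neg] at hγ; exact hγ),
      fun hγ => ((f.neg h₁).app i).pos (by rw [h, h₁, neg_one_mul, neg_inj] at hγ; exact hγ)⟩ :=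
  dif_neg (by rw [h₁]; decide)

variable {γ δ : ℤˣ} {x y z : SProd ε V}

lemma coord_id (i : ι) (h : γ = δ * ε i) :
    coord (𝟙 (⟨x⟩ : Signed δ (SProd ε V))) i h = 𝟙 _ := by
  unfold coord; split_ifs <;> rfl

lemma coord_comp (f : (⟨x⟩ : Signed δ (SProd ε V)) ⟶ ⟨y⟩)
    (g : (⟨y⟩ : Signed δ (SProd ε V)) ⟶ ⟨z⟩) (i : ι) (h : γ = δ * ε i) :
    coord (f ≫ g) i h = coord f i h ≫ coord g i h := by
  unfold coord; split_ifs <;> rfl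

lemma coord_add [Preadditive V] (f g : (⟨x⟩ : Signed δ (SProd ε V)) ⟶ ⟨y⟩) (i : ι)
    (h : γ = δ * ε i) : coord (f + g) i h = coord f i h + coord g i h := by
  unfold coord; split_ifs <;> rfl

lemma coord_smul {R : Type*} [Semiring R] [Preadditive V] [Linear R V] (r : R)
    (f : (⟨x⟩ : Signed δ (SProd ε V)) ⟶ ⟨y⟩) (i : ι)
    (h : γ = δ * ε i) : coord (r • f) i h = r • coord f i h := by
  unfold coord; split_ifs <;> rfl

lemma coord_iso (e : ∀ i, x.of i ≅ y.of i) (i : ι) (h : γ = δ * ε i) :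
    coord (Signed.iso δ (SProd.iso fun i => Signed.iso (ε i) (e i))).hom i h =
      (Signed.iso γ (e i)).hom := by
  unfold coord; split_ifs <;> rfl

lemma coord_smulIso {k : Type*} [CommRing k] [Preadditive V] [Linear k V] (c : ι → kˣ)
    (e : ∀ i, x.of i ≅ y.of i) (i : ι) (h : γ = δ * ε i) :
    coord (Signed.iso δ (SProd.iso fun i => smulIso (c i) (Signed.iso (ε i) (e i)))).hom i h =
      ((c i ^ (δ : ℤ) : kˣ) : k) • (Signed.iso γ (e i)).hom := by
  rcases Int.units_eq_one_or δ with hδ | hδ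
  · rw [coord_pos _ _ _ hδ]; simp only [hδ, Units.val_one, zpow_one]; rfl
  · rw [coord_neg _ _ _ hδ]; simp only [hδ, Units.val_neg, Units.val_one, zpow_neg, zpow_one]; rfl

lemma coord_ofOne (hδ : δ = 1) (f : x ⟶ y) (i : ι) (h : γ = δ * ε i) :
    coord (Signed.ofOne hδ f) i h = ⟨fun hγ => (f.app i).pos (by rw [← hγ, h, hδ, one_mul]),
      fun hγ => (f.app i).neg (by rw [← hγ, h, hδ, one_mul])⟩ := by
  rw [coord_pos _ _ _ hδ]; rfl

end SProd

section Psi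

lemma iso_trans_hom {V : Type*} [Category* V] (ε : ℤˣ) {x y z : V} (e : x ≅ y) (e' : y ≅ z) :
    (Signed.iso ε e).hom ≫ (Signed.iso ε e').hom = (Signed.iso ε (e ≪≫ e')).hom := rfl

variable {G : Type*} [Group G] {π : G →* ℤˣ} {k : Type*} [CommRing k] {α : TwistedCocycle π k}
  {V : Type*} [Category* V] [Preadditive V] [Linear k V] (ρ : TwistedRep α V)

lemma TwistedRep.ψ_push {γ δ ε : ℤˣ} (a b : G) (h₁ : δ = ε * π a) (h₂ : γ = δ * π b)
    (h₃ : γ = ε * π (a * b)) {x y : V} (u : (⟨x⟩ : Signed γ V) ⟶ ⟨y⟩) :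
    Signed.push (ρ.F a) h₁ (Signed.push (ρ.F b) h₂ u) ≫ (Signed.iso ε (ρ.ψ a b y)).hom =
      (Signed.iso ε (ρ.ψ a b x)).hom ≫ Signed.push (ρ.F (a * b)) h₃ u := by
  ext h
  · exact ρ.ψ_nat a b (x := x) (y := y)
      ⟨fun h' => u.pos (Signed.mul_pp h₃ h h'), fun h' => u.neg (Signed.mul_pn h₃ h h')⟩
  · have := ρ.ψ_nat a b (x := y) (y := x)
      ⟨fun h' => u.neg (Signed.mul_np h₃ h h'), fun h' => u.pos (Signed.mul_nn h₃ h h')⟩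
    exact (Iso.inv_comp_eq _).mpr (((Iso.eq_comp_inv _).mpr this).trans (Category.assoc _ _ _))

lemma TwistedRep.ψe_push {γ ε : ℤˣ} (h₁ : γ = ε * π 1) {x y : V}
    (u : (⟨x⟩ : Signed γ V) ⟶ ⟨y⟩) :
    Signed.push (ρ.F 1) h₁ u ≫ (Signed.iso ε (ρ.ψe y)).hom =
      (Signed.iso ε (ρ.ψe x)).hom ≫
        ⟨fun h => u.pos (by rw [h₁, h, π.map_one, mul_one]),
          fun h => u.neg (by rw [h₁, h, π.map_one, mul_one])⟩ := by
  have hn : ∀ h : π 1 = -1, False := fun h => absurd (π.map_one.symm.trans h) (by decide)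
  ext h
  · refine Eq.trans ?_ (ρ.ψe_nat (u.pos (by rw [h₁, h, π.map_one, mul_one])))
    refine congrArg (· ≫ _) (congrArg (ρ.F 1).map ?_)
    ext h' <;> [rfl; exact (hn h').elim]
  · have h2 : γ = -1 := by rw [h₁, h, π.map_one, mul_one]
    have := ρ.ψe_nat (u.neg h2)
    refine Eq.trans ?_ ((Iso.inv_comp_eq _).mpr
      (((Iso.eq_comp_inv _).mpr this).trans (Category.assoc _ _ _)))
    refine congrArg (_ ≫ ·) (congrArg (ρ.F 1).map ?_)
    ext h' <;> [rfl; exact (hn h').elim]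

lemma TwistedRep.cast_push {ι : Type*} {ε : ι → ℤˣ} {γ₀ δ γ γ' : ℤˣ} {x y : SProd ε V}
    (f : (⟨x⟩ : Signed γ₀ (SProd ε V)) ⟶ ⟨y⟩) {a b : G} (h : a = b) {i j : ι} (hij : i = j)
    (h₁ : γ = γ₀ * ε i) (h₂ : γ' = γ₀ * ε j) (h₃ : γ = δ * π a) (h₄ : γ' = δ * π b) :
    Signed.push (ρ.F a) h₃ (SProd.coord f i h₁) ≫
        (Signed.iso δ (castIso ρ.F h (congrArg y.of hij))).hom =
      (Signed.iso δ (castIso ρ.F h (congrArg x.of hij))).hom ≫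
        Signed.push (ρ.F b) h₄ (SProd.coord f j h₂) := by
  subst h hij
  obtain rfl : γ = γ' := h₃.trans h₄.symm
  have : ∀ z : V, (Signed.iso δ (castIso ρ.F (rfl : a = a) (rfl : z = z))).hom = 𝟙 _ :=
    fun z => rfl
  rw [this, this, Category.comp_id, Category.id_comp]

lemma TwistedRep.assoc_cast {a b c ab c' abc bc abc' : G} {x x' x₁ x₂ x₃ : V}
    (h1 : a * b = ab) (h2 : c = c') (h3 : x = x') (h3' : (ρ.F c).obj ⟨x⟩ = (ρ.F c').obj ⟨x'⟩)
    (h4 : ab * c' = abc) (h5 : x' = x₁)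
    (h6 : abc = abc') (h7 : x₁ = x₂) (h8 : b * c = bc) (h9 : a * bc = abc') (h10 : x = x₃)
    (h11 : x₃ = x₂) :
    smulIso (α.val a b c) (ρ.ψ a b ((ρ.F c).obj ⟨x⟩) ≪≫ castIso ρ.F h1 h3' ≪≫ ρ.ψ ab c' x' ≪≫
        castIso ρ.F h4 h5 ≪≫ castIso ρ.F h6 h7) =
      (ρ.F a).mapIso (Signed.iso (π a) (ρ.ψ b c x ≪≫ castIso ρ.F h8 h10)) ≪≫ ρ.ψ a bc x₃ ≪≫
        castIso ρ.F h9 h11 := by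
  subst h1 h2 h3 h4 h5 h7 h8 h9 h10
  have := ρ.assoc a b c x
  ext
  have h := congrArg Iso.hom this
  simpa [castIso] using h

lemma TwistedRep.unit_left_cast {a b b' c : G} {x x' x₁ x₂ : V} (h1 : a = 1) (h2 : a * b = c)
    (h3 : x = x₁) (h4 : c = b') (h5 : x₁ = x₂) (h6 : b = b') (h7 : x = x₂)
    (hx : (ρ.F b).obj ⟨x⟩ = x') (hx' : x' = (ρ.F b').obj ⟨x₂⟩) :
    ρ.ψ a b x ≪≫ castIso ρ.F h2 h3 ≪≫ castIso ρ.F h4 h5 =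
      castIso ρ.F h1 (hx.trans hx') ≪≫ ρ.ψe ((ρ.F b').obj ⟨x₂⟩) := by
  subst h1 h2 h3 h5 h6
  have h := congrArg Iso.hom (ρ.unit_left b x)
  ext
  simpa [castIso] using h

lemma TwistedRep.unit_right_cast {a b c a' : G} {x x₁ x₂ : V} (h1 : b = 1) (h2 : a * b = c)
    (h3 : x = x₁) (h4 : c = a') (h5 : x₁ = x₂) (h6 : a = a') (h7 : x = x₂) :
    ρ.ψ a b x ≪≫ castIso ρ.F h2 h3 ≪≫ castIso ρ.F h4 h5 =
      (ρ.F a).mapIso (Signed.iso (π a) (castIso ρ.F h1 h7 ≪≫ ρ.ψe x₂)) ≪≫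
        castIso ρ.F h6 rfl := by
  subst h1 h2 h3 h5 h6
  have h := congrArg Iso.hom (ρ.unit_right a x)
  ext
  simpa [castIso] using h

end Psi

section Induction

variable {G : Type*} [Group G] {π : G →* ℤˣ} {H : Subgroup G} {k : Type*} [CommRing k]
  {α : TwistedCocycle π k} {V : Type*} [Category* V] [Preadditive V] [Linear k V]

/-- A choice of representatives `σ_j` of the cosets `σ H`. -/
structure CosetReps (H : Subgroup G) where
  /-- the representative of the coset -/
  s : G ⧸ H → G
  mk_s : ∀ j, (s j : G ⧸ H) = j

namespace CosetReps

variable (S : CosetReps H)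

/-- The element `η` of `H` with `ω σ_i = σ_j η`, where `i = ω⁻¹ j` is the coset of `ω⁻¹ σ_j`. -/
def eta (ω : G) (j : G ⧸ H) : H :=
  ⟨(S.s j)⁻¹ * (ω * S.s (ω⁻¹ • j)), by
    rw [← QuotientGroup.eq, S.mk_s, ← smul_eq_mul, ← MulAction.Quotient.smul_coe, S.mk_s,
      smul_inv_smul]⟩

lemma s_mul_eta (ω : G) (j : G ⧸ H) : S.s j * S.eta ω j = ω * S.s (ω⁻¹ • j) := by
  simp [eta]

lemma idx_mul (ω₂ ω₁ : G) (j : G ⧸ H) : ω₁⁻¹ • ω₂⁻¹ • j = (ω₂ * ω₁)⁻¹ • j := by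
  rw [mul_inv_rev, mul_smul]

lemma idx_one (j : G ⧸ H) : (1 : G)⁻¹ • j = j := by rw [inv_one, one_smul]

lemma eta_mul (ω₂ ω₁ : G) (j : G ⧸ H) :
    S.eta ω₂ j * S.eta ω₁ (ω₂⁻¹ • j) = S.eta (ω₂ * ω₁) j := by
  apply Subtype.ext
  apply mul_left_cancel (a := S.s j)
  rw [s_mul_eta, Subgroup.coe_mul, ← mul_assoc, s_mul_eta, mul_assoc, s_mul_eta, idx_mul, mul_assoc]

lemma eta_one (j : G ⧸ H) : S.eta 1 j = 1 := by
  apply Subtype.ext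
  apply mul_left_cancel (a := S.s j)
  rw [s_mul_eta, idx_one, one_mul, Subgroup.coe_one, mul_one]

lemma sign (π : G →* ℤˣ) (ω : G) (j : G ⧸ H) :
    π ω * π (S.s (ω⁻¹ • j)) = π (S.s j) * resGrading π H (S.eta ω j) := by
  rw [← map_mul, ← s_mul_eta, map_mul]; rfl

/-- The scalar `α([ω₂|σ_j|η₁]) / (α([ω₂|ω₁|σ_i]) α([σ_k|η₂|η₁]))`, where `ω₁ σ_i = σ_j η₁` and
`ω₂ σ_j = σ_k η₂`. -/
def coeff (α : TwistedCocycle π k) (ω₂ ω₁ : G) (l : G ⧸ H) : kˣ :=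
  α.val ω₂ (S.s (ω₂⁻¹ • l)) (S.eta ω₁ (ω₂⁻¹ • l)) /
    (α.val ω₂ ω₁ (S.s (ω₁⁻¹ • ω₂⁻¹ • l)) *
      α.val (S.s l) (S.eta ω₂ l) (S.eta ω₁ (ω₂⁻¹ • l)))

end CosetReps


namespace RInd

variable (ρ : TwistedRep (α.res H) V) (S : CosetReps H)

/-- The category `∏ i, ^π(σ_i) V`. -/
abbrev Cat (π : G →* ℤˣ) (S : CosetReps H) (V : Type*) := SProd (fun i => π (S.s i)) V

/-- The functor `RInd(ω)`, given by the matrix whose `(j, i)` entry is `^π(σ_j) ρ(η)` if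
`ω σ_i = σ_j η` with `η` in `H`, and zero if there is no such `η`. For given `j`, the only nonzero
entry is the one with `i = ω⁻¹ j`. -/
def F (ω : G) : Signed (π ω) (Cat π S V) ⥤ Cat π S V where
  obj x := ⟨fun j => (ρ.F (S.eta ω j)).obj ⟨x.of.of (ω⁻¹ • j)⟩⟩
  map f := ⟨fun j => Signed.push (ρ.F (S.eta ω j)) (S.sign π ω j)
    (SProd.coord f (ω⁻¹ • j) rfl)⟩
  map_id x := SProd.hom_ext fun j => by
    exact (congrArg _ (SProd.coord_id (x := x.of) _ _)).trans (Signed.push_id _ (S.sign π ω j) _)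
  map_comp f g := SProd.hom_ext fun j => by
    exact (congrArg _ (SProd.coord_comp f g _ _)).trans (Signed.push_comp _ (S.sign π ω j) _ _)

/-- The components of the `2`-isomorphisms `RInd(ψ)_{ω₂, ω₁}`, given at the entry `(k, i)` by
`^π(σ_k) ψ_{η₂, η₁} ^ π(σ_k)`, multiplied by a scalar, where `ω₁ σ_i = σ_j η₁` and
`ω₂ σ_j = σ_k η₂`. -/
def psi (ω₂ ω₁ : G) (x : Cat π S V) :
    (F ρ S ω₂).obj ⟨(F ρ S ω₁).obj ⟨x⟩⟩ ≅ (F ρ S (ω₂ * ω₁)).obj ⟨x⟩ :=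
  SProd.iso fun l => smulIso (S.coeff α ω₂ ω₁ l) (Signed.iso (π (S.s l))
    (ρ.ψ (S.eta ω₂ l) (S.eta ω₁ (ω₂⁻¹ • l)) (x.of (ω₁⁻¹ • ω₂⁻¹ • l)) ≪≫
      castIso ρ.F (S.eta_mul ω₂ ω₁ l) (congrArg x.of (CosetReps.idx_mul ω₂ ω₁ l))))

/-- The components of the `2`-isomorphism `RInd(ψ)_e`, given by `^π(σ_i) ψ_e ^ π(σ_i)`. -/
def psiE (x : Cat π S V) : (F ρ S 1).obj ⟨x⟩ ≅ x :=
  SProd.iso fun j => Signed.iso (π (S.s j))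
    (castIso ρ.F (S.eta_one j) (congrArg x.of (CosetReps.idx_one j)) ≪≫ ρ.ψe (x.of j))

instance (ω : G) : (F ρ S ω).Additive where
  map_add {_ _ f g} := SProd.hom_ext fun j =>
    (congrArg _ (SProd.coord_add f g _ _)).trans (Signed.push_add _ (S.sign π ω j) _ _)

instance (ω : G) : (F ρ S ω).Linear k where
  map_smul f r := SProd.hom_ext fun j =>
    (congrArg _ (SProd.coord_smul r f _ _)).trans (Signed.push_smul _ (S.sign π ω j) _ _)

lemma F_map_app (ω : G) {x y : Cat π S V} (f : (⟨x⟩ : Signed (π ω) (Cat π S V)) ⟶ ⟨y⟩)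
    (j : G ⧸ H) : ((F ρ S ω).map f).app j = Signed.push (ρ.F (S.eta ω j)) (S.sign π ω j)
      (SProd.coord f (ω⁻¹ • j) rfl) := rfl

lemma coord_push {γ δ γ' γ'' : ℤˣ} (ω : G) {x y : Cat π S V} (h : γ = δ * π ω)
    (f : (⟨x⟩ : Signed γ (Cat π S V)) ⟶ ⟨y⟩) (j : G ⧸ H) (h' : γ' = δ * π (S.s j))
    (h'' : γ'' = γ * π (S.s (ω⁻¹ • j))) (h₃ : γ'' = γ' * resGrading π H (S.eta ω j)) :
    SProd.coord (Signed.push (F ρ S ω) h f) j h' =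
      Signed.push (ρ.F (S.eta ω j)) h₃ (SProd.coord f (ω⁻¹ • j) h'') := by
  rcases Int.units_eq_one_or δ with hδ | hδ
  · rw [SProd.coord_pos _ _ _ hδ]
    ext hγ
    · refine congrArg (ρ.F (S.eta ω j)).map ?_
      rcases Int.units_eq_one_or (π ω) with hω | hω
      · rw [SProd.coord_pos _ _ _ hω, SProd.coord_pos f _ _ (by rw [h, hδ, hω]; rfl)]
      · rw [SProd.coord_neg _ _ _ hω, SProd.coord_neg f _ _ (by rw [h, hδ, hω]; rfl)]
    · refine congrArg (ρ.F (S.eta ω j)).map ?_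
      rcases Int.units_eq_one_or (π ω) with hω | hω
      · rw [SProd.coord_pos _ _ _ hω, SProd.coord_pos f _ _ (by rw [h, hδ, hω]; rfl)]
      · rw [SProd.coord_neg _ _ _ hω, SProd.coord_neg f _ _ (by rw [h, hδ, hω]; rfl)]
  · rw [SProd.coord_neg _ _ _ hδ]
    ext hγ
    · refine congrArg (ρ.F (S.eta ω j)).map ?_
      rcases Int.units_eq_one_or (π ω) with hω | hω
      · rw [SProd.coord_pos _ _ _ hω, SProd.coord_neg f _ _ (by rw [h, hδ, hω]; rfl)]
      · rw [SProd.coord_neg _ _ _ hω, SProd.coord_pos f _ _ (by rw [h, hδ, hω]; rfl)]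
    · refine congrArg (ρ.F (S.eta ω j)).map ?_
      rcases Int.units_eq_one_or (π ω) with hω | hω
      · rw [SProd.coord_pos _ _ _ hω, SProd.coord_neg f _ _ (by rw [h, hδ, hω]; rfl)]
      · rw [SProd.coord_neg _ _ _ hω, SProd.coord_pos f _ _ (by rw [h, hδ, hω]; rfl)]

lemma psi_nat (ω₂ ω₁ : G) {x y : Cat π S V}
    (f : (⟨x⟩ : Signed (π (ω₂ * ω₁)) (Cat π S V)) ⟶ ⟨y⟩) :
    (F ρ S ω₂).map (Signed.push (F ρ S ω₁) (π.map_mul ω₂ ω₁) f) ≫ (psi ρ S ω₂ ω₁ y).hom =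
      (psi ρ S ω₂ ω₁ x).hom ≫ (F ρ S (ω₂ * ω₁)).map f := by
  refine SProd.hom_ext fun l => ?_
  have e : π (ω₂ * ω₁) * π (S.s (ω₁⁻¹ • ω₂⁻¹ • l)) =
      π ω₂ * π (S.s (ω₂⁻¹ • l)) * resGrading π H (S.eta ω₁ (ω₂⁻¹ • l)) := by
    rw [map_mul, mul_assoc, S.sign π ω₁, mul_assoc]
  have e' : π (ω₂ * ω₁) * π (S.s (ω₁⁻¹ • ω₂⁻¹ • l)) =
      π (S.s l) * resGrading π H (S.eta ω₂ l * S.eta ω₁ (ω₂⁻¹ • l)) := by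
    rw [e, S.sign π ω₂, map_mul, mul_assoc]
  have h0 := coord_push ρ S ω₁ (π.map_mul ω₂ ω₁) f (ω₂⁻¹ • l) rfl rfl e
  have h1 := ρ.ψ_push (S.eta ω₂ l) (S.eta ω₁ (ω₂⁻¹ • l)) (S.sign π ω₂ l) e e'
    (SProd.coord f (ω₁⁻¹ • ω₂⁻¹ • l) rfl)
  have h2 := ρ.cast_push f (S.eta_mul ω₂ ω₁ l) (CosetReps.idx_mul ω₂ ω₁ l) rfl rfl e'
    (S.sign π (ω₂ * ω₁) l)
  have key := h1 =≫ (Signed.iso (π (S.s l)) (castIso ρ.F (S.eta_mul ω₂ ω₁ l)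
    (congrArg y.of (CosetReps.idx_mul ω₂ ω₁ l)))).hom
  rw [Category.assoc, Category.assoc, h2, ← Category.assoc (Signed.iso _ _).hom,
    iso_trans_hom, iso_trans_hom] at key
  refine (congrArg (· ≫ _) (congrArg (Signed.push _ (S.sign π ω₂ l)) h0)).trans ?_
  exact (Linear.comp_smul _ _ _ _ _ _).trans
    ((congrArg (((S.coeff α ω₂ ω₁ l : kˣ) : k) • ·) key).trans
      (Linear.smul_comp _ _ _ _ _ _).symm)

lemma psiE_nat {x y : Cat π S V} (f : x ⟶ y) :
    (F ρ S 1).map (Signed.ofOne π.map_one f) ≫ (psiE ρ S y).hom = (psiE ρ S x).hom ≫ f := by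
  refine SProd.hom_ext fun j => ?_
  have e : π 1 * π (S.s j) = π (S.s j) * resGrading π H 1 := by simp
  have h2 := ρ.cast_push (Signed.ofOne π.map_one f) (S.eta_one j) (CosetReps.idx_one j) rfl rfl
    (S.sign π 1 j) e
  have h3 := ρ.ψe_push e (SProd.coord (Signed.ofOne π.map_one f) j rfl)
  have key := h2 =≫ (Signed.iso (π (S.s j)) (ρ.ψe (y.of j))).hom
  rw [Category.assoc, Category.assoc, h3, ← Category.assoc (Signed.iso _ _).hom,
    iso_trans_hom, iso_trans_hom] at key
  refine key.trans (congrArg (_ ≫ ·) ?_)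
  rw [SProd.coord_ofOne]
  rfl

lemma castIso_app {a b : G} (h : a = b) (x : Cat π S V) (j : G ⧸ H) :
    (castIso (F ρ S) h (rfl : x = x)).hom.app j =
      (Signed.iso (π (S.s j)) (castIso ρ.F (congrArg (S.eta · j) h)
        (congrArg (fun c : G => x.of (c⁻¹ • j)) h))).hom := by
  subst h; rfl

lemma coeff_assoc (α : TwistedCocycle π k) (ω₃ ω₂ ω₁ : G) (l : G ⧸ H) :
    α.val ω₃ ω₂ ω₁ * (S.coeff α ω₃ ω₂ l * S.coeff α (ω₃ * ω₂) ω₁ l) =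
      S.coeff α ω₂ ω₁ (ω₃⁻¹ • l) ^ (π ω₃ : ℤ) * S.coeff α ω₃ (ω₂ * ω₁) l *
        α.val (S.eta ω₃ l) (S.eta ω₂ (ω₃⁻¹ • l)) (S.eta ω₁ (ω₂⁻¹ • ω₃⁻¹ • l)) ^
          (π (S.s l) : ℤ) := by
  have e3 := S.s_mul_eta ω₃ l
  have e2 := S.s_mul_eta ω₂ (ω₃⁻¹ • l)
  have e1 := S.s_mul_eta ω₁ (ω₂⁻¹ • ω₃⁻¹ • l)
  have e32 := congrArg Subtype.val (S.eta_mul ω₃ ω₂ l)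
  have e21 := congrArg Subtype.val (S.eta_mul ω₂ ω₁ (ω₃⁻¹ • l))
  rw [Subgroup.coe_mul] at e32 e21
  simp only [CosetReps.coeff, ← CosetReps.idx_mul, ← e32, ← e21]
  generalize (S.eta ω₃ l : G) = η₃ at *
  generalize (S.eta ω₂ (ω₃⁻¹ • l) : G) = η₂ at *
  generalize (S.eta ω₁ (ω₂⁻¹ • ω₃⁻¹ • l) : G) = η₁ at *
  generalize S.s (ω₁⁻¹ • ω₂⁻¹ • ω₃⁻¹ • l) = I at *
  generalize S.s (ω₂⁻¹ • ω₃⁻¹ • l) = J at *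
  generalize S.s (ω₃⁻¹ • l) = K at *
  generalize S.s l = L at *
  have c1 := α.cocycle ω₃ ω₂ ω₁ I
  have c2 := α.cocycle ω₃ ω₂ J η₁
  have c3 := α.cocycle ω₃ K η₂ η₁
  have c4 := α.cocycle L η₃ η₂ η₁
  rw [← e1] at c1
  rw [← e2] at c2
  rw [← e3] at c3
  rw [div_zpow, mul_zpow]
  apply Additive.ofMul.injective
  apply_fun Additive.ofMul at c1 c2 c3 c4
  simp only [ofMul_mul, ofMul_div, ofMul_zpow] at c1 c2 c3 c4 ⊢
  rw [← sub_eq_zero] at c1 c2 c3 c4 ⊢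
  refine Eq.trans ?_ (congrArg₂ (· - ·) (congrArg₂ (· + ·) c1 c3) (congrArg₂ (· + ·) c2 c4)
    |>.trans (by simp))
  abel

lemma psi_assoc (ω₃ ω₂ ω₁ : G) (x : Cat π S V) :
    smulIso (α.val ω₃ ω₂ ω₁) (psi ρ S ω₃ ω₂ ((F ρ S ω₁).obj ⟨x⟩) ≪≫ psi ρ S (ω₃ * ω₂) ω₁ x) ≪≫
        castIso (F ρ S) (mul_assoc ω₃ ω₂ ω₁) rfl =
      (F ρ S ω₃).mapIso (Signed.iso (π ω₃) (psi ρ S ω₂ ω₁ x)) ≪≫ psi ρ S ω₃ (ω₂ * ω₁) x := by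
  apply Iso.ext
  refine SProd.hom_ext fun l => ?_
  have core := ρ.assoc_cast (S.eta_mul ω₃ ω₂ l)
    (congrArg (S.eta ω₁) (CosetReps.idx_mul ω₃ ω₂ l))
    (congrArg (fun i => x.of (ω₁⁻¹ • i)) (CosetReps.idx_mul ω₃ ω₂ l))
    (congrArg ((F ρ S ω₁).obj ⟨x⟩).of (CosetReps.idx_mul ω₃ ω₂ l))
    (S.eta_mul (ω₃ * ω₂) ω₁ l) (congrArg x.of (CosetReps.idx_mul (ω₃ * ω₂) ω₁ l))
    (congrArg (S.eta · l) (mul_assoc ω₃ ω₂ ω₁))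
    (congrArg (fun c : G => x.of (c⁻¹ • l)) (mul_assoc ω₃ ω₂ ω₁))
    (S.eta_mul ω₂ ω₁ (ω₃⁻¹ • l)) (S.eta_mul ω₃ (ω₂ * ω₁) l)
    (congrArg x.of (CosetReps.idx_mul ω₂ ω₁ (ω₃⁻¹ • l)))
    (congrArg x.of (CosetReps.idx_mul ω₃ (ω₂ * ω₁) l))
  have hco := SProd.coord_smulIso (δ := π ω₃) (ε := fun i => π (S.s i))
    (S.coeff α ω₂ ω₁) (fun l =>
    (ρ.ψ (S.eta ω₂ l) (S.eta ω₁ (ω₂⁻¹ • l)) (x.of (ω₁⁻¹ • ω₂⁻¹ • l)) ≪≫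
      castIso ρ.F (S.eta_mul ω₂ ω₁ l) (congrArg x.of (CosetReps.idx_mul ω₂ ω₁ l))))
    (x := (F ρ S ω₂).obj ⟨(F ρ S ω₁).obj ⟨x⟩⟩) (y := (F ρ S (ω₂ * ω₁)).obj ⟨x⟩)
    (ω₃⁻¹ • l) rfl
  have hR : ((F ρ S ω₃).map (Signed.iso (π ω₃) (psi ρ S ω₂ ω₁ x)).hom).app l =
      ((S.coeff α ω₂ ω₁ (ω₃⁻¹ • l) ^ (π ω₃ : ℤ) : kˣ) : k) • (Signed.iso (π (S.s l))
        ((ρ.F (S.eta ω₃ l)).mapIso (Signed.iso (resGrading π H (S.eta ω₃ l)) _))).hom :=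
    ((congrArg (Signed.push _ (S.sign π ω₃ l)) hco).trans
      (Signed.push_smul _ (S.sign π ω₃ l) _ _)).trans
      (congrArg (_ • ·) (Signed.push_iso _ (S.sign π ω₃ l) _))
  have hc := castIso_app ρ S (mul_assoc ω₃ ω₂ ω₁) x l
  have core' := congrArg (fun e => (Signed.iso (π (S.s l)) e).hom) core
  simp only [iso_smulIso, smulIso_hom, ← iso_trans_hom, TwistedCocycle.res_val] at core'
  refine Eq.trans (congrArg (_ ≫ ·) hc) (Eq.trans ?_ (congrArg (· ≫ _) hR).symm)
  have sc := congrArg Units.val (coeff_assoc S α ω₃ ω₂ ω₁ l)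
  have aux : ∀ {a b c d e f g : Signed (π (S.s l)) V} (p₁ : a ⟶ b) (p₂ : b ⟶ c) (p₃ : c ⟶ d)
      (p₄ : d ⟶ e) (p₅ : e ⟶ f) (q₁ : a ⟶ g) (q₂ : g ⟶ f) (r₀ r₁ r₂ t₁ t₂ w : k),
      r₀ * (r₁ * r₂) = t₁ * t₂ * w → w • (p₁ ≫ p₂ ≫ p₃ ≫ p₄ ≫ p₅) = q₁ ≫ q₂ →
      (r₀ • ((r₁ • (p₁ ≫ p₂)) ≫ (r₂ • (p₃ ≫ p₄)))) ≫ p₅ = (t₁ • q₁) ≫ (t₂ • q₂) := by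
    intro a b c d e f g p₁ p₂ p₃ p₄ p₅ q₁ q₂ r₀ r₁ r₂ t₁ t₂ w h h'
    simp only [Linear.smul_comp, Linear.comp_smul, smul_smul, Category.assoc, ← h']
    congr 1
    linear_combination h
  rw [Units.val_mul, Units.val_mul, Units.val_mul, Units.val_mul] at sc
  exact aux _ _ _ _ _ _ _ _ _ _ _ _ _ sc core'

lemma psi_unit_left (ω : G) (x : Cat π S V) :
    psi ρ S 1 ω x ≪≫ castIso (F ρ S) (one_mul ω) rfl = psiE ρ S ((F ρ S ω).obj ⟨x⟩) := by
  apply Iso.ext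
  refine SProd.hom_ext fun l => ?_
  have core := ρ.unit_left_cast (S.eta_one l) (S.eta_mul 1 ω l)
    (congrArg x.of (CosetReps.idx_mul 1 ω l)) (congrArg (S.eta · l) (one_mul ω))
    (congrArg (fun c : G => x.of (c⁻¹ • l)) (one_mul ω))
    (congrArg (S.eta ω) (CosetReps.idx_one l))
    (congrArg (fun i => x.of (ω⁻¹ • i)) (CosetReps.idx_one l)) rfl
    (congrArg ((F ρ S ω).obj ⟨x⟩).of (CosetReps.idx_one l))
  have hc := castIso_app ρ S (one_mul ω) x l
  have core' := congrArg (fun e => (Signed.iso (π (S.s l)) e).hom) core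
  have sc : S.coeff α 1 ω l = 1 := by
    simp [CosetReps.coeff, CosetReps.eta_one, α.one_left, α.one_mid]
  refine Eq.trans (congrArg (_ ≫ ·) hc) (Eq.trans ?_ core')
  change (((S.coeff α 1 ω l : kˣ) : k) • _) ≫ _ = _
  rw [sc, Units.val_one, one_smul]
  exact (iso_trans_hom _ _ _).trans
    (congrArg (fun e => (Signed.iso (π (S.s l)) e).hom) (Iso.trans_assoc _ _ _))

lemma psi_unit_right (ω : G) (x : Cat π S V) :
    psi ρ S ω 1 x ≪≫ castIso (F ρ S) (mul_one ω) rfl =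
      (F ρ S ω).mapIso (Signed.iso (π ω) (psiE ρ S x)) := by
  apply Iso.ext
  refine SProd.hom_ext fun l => ?_
  have core := ρ.unit_right_cast (a' := S.eta ω l) (S.eta_one (ω⁻¹ • l)) (S.eta_mul ω 1 l)
    (congrArg x.of (CosetReps.idx_mul ω 1 l)) (congrArg (S.eta · l) (mul_one ω))
    (congrArg (fun c : G => x.of (c⁻¹ • l)) (mul_one ω)) rfl
    (congrArg x.of (CosetReps.idx_one (ω⁻¹ • l)))
  have hc := castIso_app ρ S (mul_one ω) x l
  have core' := congrArg (fun e => (Signed.iso (π (S.s l)) e).hom) core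
  have sc : S.coeff α ω 1 l = 1 := by
    simp [CosetReps.coeff, CosetReps.eta_one, α.one_right, α.one_mid]
  have hco := SProd.coord_iso (δ := π ω) (ε := fun i => π (S.s i))
    (x := (F ρ S 1).obj ⟨x⟩) (y := x)
    (fun j => castIso ρ.F (S.eta_one j) (congrArg x.of (CosetReps.idx_one j)) ≪≫ ρ.ψe (x.of j))
    (ω⁻¹ • l) rfl
  have hR : ((F ρ S ω).map (Signed.iso (π ω) (psiE ρ S x)).hom).app l =
      (Signed.iso (π (S.s l))
        ((ρ.F (S.eta ω l)).mapIso (Signed.iso (resGrading π H (S.eta ω l)) _))).hom :=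
    (congrArg (Signed.push _ (S.sign π ω l)) hco).trans (Signed.push_iso _ (S.sign π ω l) _)
  refine Eq.trans (congrArg (_ ≫ ·) hc) (Eq.trans ?_ hR.symm)
  have hcast : ∀ (e : H) (z : V), castIso ρ.F (rfl : e = e) (rfl : z = z) = Iso.refl _ :=
    fun _ _ => rfl
  rw [hcast, Iso.trans_refl] at core'
  refine Eq.trans ?_ core'
  change (((S.coeff α ω 1 l : kˣ) : k) • _) ≫ _ = _
  rw [sc, Units.val_one, one_smul]
  exact (iso_trans_hom _ _ _).trans
    (congrArg (fun e => (Signed.iso (π (S.s l)) e).hom) (Iso.trans_assoc _ _ _))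

end RInd

/-- The Real `2`-induction of `ρ` from `H` to `G`, with respect to a choice of representatives of
the cosets. -/
def RInd (ρ : TwistedRep (α.res H) V) (S : CosetReps H) : TwistedRep α (RInd.Cat π S V) where
  F := RInd.F ρ S
  additive _ := inferInstance
  linear _ := inferInstance
  ψ := RInd.psi ρ S
  ψ_nat ω₂ ω₁ _ _ f := RInd.psi_nat ρ S ω₂ ω₁ f
  ψe := RInd.psiE ρ S
  ψe_nat f := RInd.psiE_nat ρ S f
  assoc := RInd.psi_assoc ρ S
  unit_left := RInd.psi_unit_left ρ S
  unit_right := RInd.psi_unit_right ρ S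

end Induction

noncomputable instance {G : Type*} [Group G] [Fintype G] {π : G →* ℤˣ} (p : GComm π)
    (H : Subgroup G) : Fintype {σ : G // (p.conj σ).Mem H} :=
  Fintype.ofFinite _

end Real2

/-! Write `G` and `H` for the graded groups. Two facts give the formula: the maps `β` compose up to
the transgression of `α`, and the categorical trace of the induced representation splits into blocks
indexed by `G ⧸ H`.

Composition law (`TwistedRep.beta_beta`): `β_b β_a = τ(b, a, g) β_{ba}` with `τ` equal to `tauRef`.
On an object `ρ(ω) y` the map `β_ω` needs no cap isomorphisms (`ev_beta_comp`), and since `ρ(ba)` is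
an equivalence it suffices to compare both sides on its image. There every factor of `τ` arises from
one use of twisted associativity or of the zigzag identity. Factoring `σω` also as `(σωσ⁻¹)σ` gives
`β_{σωσ⁻¹} β_σ = ττ · β_σ β_ω` (`beta_conj_comp`).

Blocks: the projections onto the factors of the product category are natural endomorphisms of the
identity, so they act on the traces as orthogonal idempotents with sum `1`. The map `β_ω` carries
block `j` to block `ωj`, and naturality identifies block `j` with block `gj` on the trace of `g`.
Hence block `j` contributes to the trace of `β_ω` only if `g` and `ω` both fix `j`.

Base block: project to the factor of the trivial coset and apply `ρ(s)`, where `s` in `H` represents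
this coset. The functor `ρ(s)` corrects both the choice of `s` and a possible reversal of the
factor. The result is an intertwiner from the restriction of the induced representation to `ρ`
(`baseIntertwiner`). On the trace of an element of `H` it is surjective with the same kernel as the
base block, so the trace of `β_ω` on this block is the character of `ρ`.

Conclusion: if `σj` is the trivial coset, conjugation by `β_σ` moves block `j` to the base block and
costs the factor `ττ⁻¹` (`trace_beta_block`). Each coset has the form `σ⁻¹H` for exactly `|H|`
elements `σ`, and `|H|` is twice the order of the degree-one part of `H`. Dividing the sum over `σ`
by it gives the sum over the cosets. -/

namespace Real2

/-! ### Coherence isomorphisms and the value of `β` on the image of `ρ(ω)` -/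

section Coherence

/-- A morphism of `^γ C`, read as a morphism of `^δ C` for `γ = δ`. -/
@[simps]
def Signed.recast {γ δ : ℤˣ} {C : Type*} [Category* C] (h : γ = δ) {x y : C}
    (f : (⟨x⟩ : Signed γ C) ⟶ ⟨y⟩) : (⟨x⟩ : Signed δ C) ⟶ ⟨y⟩ where
  pos h' := f.pos (h.trans h')
  neg h' := f.neg (h.trans h')

variable {G : Type*} [Group G] {π : G →* ℤˣ} {k : Type*} [CommRing k] {α : TwistedCocycle π k}
  {V : Type*} [Category* V] [Preadditive V] [Linear k V] (ρ : TwistedRep α V)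

namespace TwistedRep

/-- The isomorphism `ψ_{a,b}` from `ρ(a) ∘ ρ(b)` to `ρ(c)` for `a b = c`. -/
def mu {a b c : G} (h : a * b = c) (x : V) :
    (ρ.F a).obj ⟨(ρ.F b).obj ⟨x⟩⟩ ≅ (ρ.F c).obj ⟨x⟩ :=
  ρ.ψ a b x ≪≫ castIso ρ.F h rfl

/-- All products are free variables tied by equations, so associativity can be used later without
transporting along equalities of group elements. -/
lemma mu_assoc {a b c p q r : G} (hab : a * b = p) (hbc : b * c = q) (hp : p * c = r)
    (hq : a * q = r) (x : V) :
    (ρ.F a).map (Signed.iso (π a) (ρ.mu hbc x)).hom ≫ (ρ.mu hq x).hom =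
      (α.val a b c : k) • ((ρ.mu hab ((ρ.F c).obj ⟨x⟩)).hom ≫ (ρ.mu hp x).hom) := by
  have := congrArg Iso.hom (ρ.assoc_cast (x := x) hab (rfl : c = c) rfl rfl hp rfl rfl rfl hbc hq
    rfl rfl)
  simpa [mu, castIso] using this.symm

lemma mu_push {γ δ ε : ℤˣ} {a b c : G} (h : a * b = c) (h₁ : δ = ε * π a) (h₂ : γ = δ * π b)
    (h₃ : γ = ε * π c) {x y : V} (u : (⟨x⟩ : Signed γ V) ⟶ ⟨y⟩) :
    Signed.push (ρ.F a) h₁ (Signed.push (ρ.F b) h₂ u) ≫ (Signed.iso ε (ρ.mu h y)).hom =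
      (Signed.iso ε (ρ.mu h x)).hom ≫ Signed.push (ρ.F c) h₃ u := by
  subst h
  have : ∀ z, ρ.mu (rfl : a * b = a * b) z = ρ.ψ a b z := fun z => by
    ext; simp [mu, castIso]
  rw [this, this]
  exact ρ.ψ_push a b h₁ h₂ h₃ u

lemma mu_nat {γ : ℤˣ} {a b c : G} (h : a * b = c) (h₁ : γ = π a * π b) (h₂ : γ = π c) {x y : V}
    (f : (⟨x⟩ : Signed γ V) ⟶ ⟨y⟩) :
    (ρ.F a).map (Signed.push (ρ.F b) h₁ f) ≫ (ρ.mu h y).hom =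
      (ρ.mu h x).hom ≫ (ρ.F c).map (Signed.recast h₂ f) := by
  subst h h₂
  have : ∀ z, ρ.mu (rfl : a * b = a * b) z = ρ.ψ a b z := fun z => by
    ext; simp [mu, castIso]
  rw [this, this]
  exact ρ.ψ_nat a b f

lemma mu_one_left (a : G) (x : V) : ρ.mu (one_mul a) x = ρ.ψe ((ρ.F a).obj ⟨x⟩) :=
  ρ.unit_left a x

lemma mu_one_right (a : G) (x : V) :
    (ρ.mu (mul_one a) x).hom = (ρ.F a).map (Signed.iso (π a) (ρ.ψe x)).hom :=
  congrArg Iso.hom (ρ.unit_right a x)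

lemma cap_eq {a b : G} (h : a * b = 1) (x : V) : ρ.cap h x = ρ.mu h x ≪≫ ρ.ψe x := by
  ext; simp [cap, mu]

/-- Twisted associativity for `a, b, a`, where the unit laws turn the two outer multiplications into
`ψ_e`. The triangle identity therefore fails exactly by `α(a, b, a)`. -/
lemma zigzag {a b : G} (hab : a * b = 1) (hba : b * a = 1) (x : V) :
    (ρ.F a).map (Signed.iso (π a) (ρ.cap hba x)).hom =
      (α.val a b a : k) • (ρ.cap hab ((ρ.F a).obj ⟨x⟩)).hom := by
  have h := ρ.mu_assoc hab hba (one_mul a) (mul_one a) x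
  rw [cap_eq, cap_eq, ← iso_trans_hom, Functor.map_comp, ← mu_one_right, h, mu_one_left]
  rfl

lemma cap_push {γ δ ε : ℤˣ} {a b : G} (h : a * b = 1) (h₁ : δ = ε * π a) (h₂ : γ = δ * π b)
    (h₃ : γ = ε) {x y : V} (u : (⟨x⟩ : Signed γ V) ⟶ ⟨y⟩) :
    Signed.push (ρ.F a) h₁ (Signed.push (ρ.F b) h₂ u) ≫ (Signed.iso ε (ρ.cap h y)).hom =
      (Signed.iso ε (ρ.cap h x)).hom ≫ Signed.recast h₃ u := by
  have e : γ = ε * π 1 := by rw [map_one, mul_one, h₃]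
  have h4 := ρ.mu_push h h₁ h₂ e u
  have h5 := ρ.ψe_push e u
  rw [cap_eq, cap_eq, ← iso_trans_hom, ← iso_trans_hom, ← Category.assoc, h4, Category.assoc, h5]
  exact (Category.assoc _ _ _).symm

lemma push_one {a : G} (h : π a = 1 * π a) {x y : V} (f : (⟨x⟩ : Signed (π a) V) ⟶ ⟨y⟩) :
    Signed.push (ρ.F a) h f = Signed.ofOne rfl ((ρ.F a).map f) := by
  ext h' <;> [rfl; exact absurd h' (by decide)]

/-- The equivalence `ρ(a) : ^π(a) V ≌ V`. -/
noncomputable def equiv (a : G) : Signed (π a) V ≌ V :=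
  have hs : (1 : ℤˣ) = π a * π a⁻¹ := by rw [← map_mul, mul_inv_cancel, map_one]
  have hs' : π a = 1 * π a := (one_mul _).symm
  -- The triangle identities hold only up to a scalar; this constructor does not ask for them, as it
  -- corrects the unit itself.
  CategoryTheory.Equivalence.mk (ρ.F a)
    { obj := fun x => ⟨(ρ.F a⁻¹).obj ⟨x⟩⟩
      map := fun f => Signed.push (ρ.F a⁻¹) hs (Signed.ofOne rfl f)
      map_id := fun x => by rw [Signed.ofOne_id, Signed.push_id]
      map_comp := fun f g => by rw [Signed.ofOne_comp, Signed.push_comp] }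
    (NatIso.ofComponents (fun x => (Signed.iso (π a) (ρ.cap (inv_mul_cancel a) x.of)).symm)
      (fun {x y} f => by
        have h := ρ.cap_push (inv_mul_cancel a) hs hs' rfl f
        rw [push_one] at h
        exact (Iso.eq_inv_comp _).mpr ((Category.assoc _ _ _).symm.trans
          ((Iso.comp_inv_eq _).mpr h.symm))))
    (NatIso.ofComponents (fun x => ρ.cap (mul_inv_cancel a) x)
      (fun {x y} f => by
        have h := ρ.cap_naturality (mul_inv_cancel a) f
        exact h))

instance (a : G) : (ρ.F a).IsEquivalence := (ρ.equiv a).isEquivalence_functor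

lemma actMap_id (g : π.ker) (x : V) : ρ.actMap g (𝟙 x) = 𝟙 _ := (ρ.act g).map_id x

lemma actMap_iso (g : π.ker) {x y : V} (e : x ≅ y) :
    ρ.actMap g e.hom = ((ρ.F g).map (Signed.iso (π g) e).hom) := by
  refine congrArg (ρ.F g).map ?_
  ext h <;> [rfl; exact absurd h (ker_ne _)]

/-- By `zigzag` the cap at `ρ(ω) y` is, up to a scalar, the image under `ρ(ω)` of a cap at `y`.
Naturality of `slide` moves it across, the scalar occurs on both sides and cancels, and the two caps
in `β` annihilate each other. -/
lemma ev_beta_comp {ω : G} {g g' : π.ker} (h : ω * ↑(g ^ (π ω : ℤ)) = ↑g' * ω) (φ : ρ.Tr g)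
    (y : V) : ρ.ev (ρ.beta h φ) ((ρ.F ω).obj ⟨y⟩) = ρ.slide h φ y := by
  change ρ.betaApp h φ _ = _
  have hz := ρ.zigzag (mul_inv_cancel ω) (inv_mul_cancel ω) y
  have hn := ρ.slide_naturality h φ (Signed.iso (π ω) (ρ.cap (inv_mul_cancel ω) y)).hom
  rw [hz, actMap_smul, Linear.smul_comp, Linear.comp_smul] at hn
  have hn' := congrArg (((α.val ω ω⁻¹ ω)⁻¹ : kˣ) • ·) hn
  simp only [Units.smul_def, smul_smul, Units.inv_mul, one_smul] at hn'
  rw [betaApp, ← hn', Iso.inv_hom_id_assoc]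

lemma ev_iso {g : π.ker} (φ : ρ.Tr g) {x y : V} (e : x ≅ y) :
    ρ.ev φ y = e.inv ≫ ρ.ev φ x ≫ ρ.actMap g e.hom := by
  rw [Iso.eq_inv_comp, ev_naturality]

lemma Tr_ext {g : π.ker} {φ φ' : ρ.Tr g} (h : ∀ x, ρ.ev φ x = ρ.ev φ' x) : φ = φ' :=
  NatTrans.ext (funext h)

/-- Elements of the categorical trace are determined by their values on the image of an
essentially surjective functor. -/
lemma Tr_ext_of_essSurj {C : Type*} [Category* C] (P : C ⥤ V) [P.EssSurj] {g : π.ker}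
    {φ φ' : ρ.Tr g} (h : ∀ x, ρ.ev φ (P.obj x) = ρ.ev φ' (P.obj x)) : φ = φ' := by
  refine ρ.Tr_ext fun x => ?_
  rw [ρ.ev_iso φ (P.objObjPreimageIso x), ρ.ev_iso φ' (P.objObjPreimageIso x), h]

/-- The transformation `1 ⟶ ^ε ρ(u)` induced by `φ : 1 ⟶ ρ(g)`, for `u = g ^ ε`. -/
def signTwist (ε : ℤˣ) {g u : π.ker} (hu : u = g ^ (ε : ℤ)) (φ : ρ.Tr g) (x : V) :
    (⟨x⟩ : Signed ε V) ⟶ ⟨(ρ.F u).obj ⟨x⟩⟩ where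
  pos h := ρ.ev φ x ≫ (castIso ρ.F (a := ↑g) (by simp [hu, h]) rfl).hom
  neg h := ρ.actMap u (ρ.ev φ x) ≫ (ρ.cap (a := ↑u) (b := ↑g) (by simp [hu, h]) x).hom

lemma cast_actMap_cap {g u u' : π.ker} (h : (u : G) = u') (h' : (u' : G) * g = 1) (φ : ρ.Tr g)
    (x : V) : (castIso ρ.F h rfl).hom ≫ ρ.actMap u' (ρ.ev φ x) ≫ (ρ.cap h' x).hom =
      ρ.actMap u (ρ.ev φ x) ≫ (ρ.cap (h ▸ h') x).hom := by
  obtain rfl : u = u' := Subtype.ext h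
  simp [castIso]

lemma twist_eq_signTwist (ω : G) {g : π.ker} (φ : ρ.Tr g) (x : V) :
    ρ.twist ω φ x = ρ.signTwist (π ω) rfl φ x := by
  ext h
  · rfl
  · exact ρ.cast_actMap_cap _ _ φ x

/-- Gives names to `g ^ π(ω)` and to the common product, so that `mu_assoc` and `mu_nat` apply to a
slide directly. -/
lemma slide_eq {ω m : G} {g g' u : π.ker} (h : ω * ↑(g ^ (π ω : ℤ)) = ↑g' * ω)
    (hu : u = g ^ (π ω : ℤ)) (hm : ω * u = m) (hm' : g' * ω = m) (φ : ρ.Tr g) (y : V) :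
    ρ.slide h φ y = (ρ.F ω).map (ρ.signTwist (π ω) hu φ y) ≫ (ρ.mu hm y).hom ≫
      (ρ.mu hm' y).inv := by
  subst hu hm'
  rw [slide, twist_eq_signTwist]
  simp [mu, castIso]

end TwistedRep
end Coherence
-- The composition law of the maps `β` and the transgression
section Composition

/-- A morphism of `^(-δ) C`, read as a morphism of `^δ C` in the opposite direction. -/
@[simps]
def Signed.flip {γ δ : ℤˣ} {C : Type*} [Category* C] (h : γ = -δ) {x y : C}
    (f : (⟨x⟩ : Signed γ C) ⟶ ⟨y⟩) : (⟨y⟩ : Signed δ C) ⟶ ⟨x⟩ where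
  pos h' := f.neg (by rw [h, h'])
  neg h' := f.pos (by rw [h, h', neg_neg])

variable {G : Type*} [Group G] {π : G →* ℤˣ} {k : Type*} [CommRing k] {α : TwistedCocycle π k}
  {V : Type*} [Category* V] [Preadditive V] [Linear k V] (ρ : TwistedRep α V)

lemma eq_units_inv_smul {M : Type*} [AddCommGroup M] [Module k M] {c : kˣ} {f g : M}
    (h : f = (c : k) • g) : g = ((c⁻¹ : kˣ) : k) • f := by
  rw [h, smul_smul, Units.inv_mul, one_smul]

namespace TwistedRep

lemma actMap_map {a : G} (w : π.ker) {x y : V} (f : (⟨x⟩ : Signed (π a) V) ⟶ ⟨y⟩)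
    (h : π a = π w * π a) :
    ρ.actMap w ((ρ.F a).map f) = (ρ.F w).map (Signed.push (ρ.F a) h f) := by
  refine congrArg (ρ.F w).map ?_
  ext h' <;> [rfl; exact absurd h' (ker_ne _)]

lemma actMap_actMap_cap {u u' : π.ker} (h : (u : G) * u' = 1) {x y : V} (f : x ⟶ y) :
    ρ.actMap u (ρ.actMap u' f) ≫ (ρ.cap h y).hom = (ρ.cap h x).hom ≫ f := by
  have h4 := ρ.cap_naturality h f
  rw [push_ker] at h4
  refine Eq.trans (congrArg (· ≫ _) (congrArg (ρ.F u).map ?_)) h4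
  ext h' <;> [rfl; exact absurd h' (ker_ne _)]

lemma cast_cap {u u' v : π.ker} (h : (u' : G) = v) (hu : (u : G) * u' = 1) (x : V)
    (f : x ⟶ (ρ.F u').obj ⟨x⟩) :
    ρ.actMap u (f ≫ (castIso ρ.F h rfl).hom) ≫ (ρ.cap (h ▸ hu) x).hom =
      ρ.actMap u f ≫ (ρ.cap hu x).hom := by
  obtain rfl : u' = v := Subtype.ext h
  simp [castIso]

/-- Dualizing `φ` twice returns `φ` up to the zigzag scalar of `g, g⁻¹`. This is the origin of the
factor `α([γ|γ⁻¹|γ])^δ` of the transgression. -/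
lemma inv_cap_actMap_opposite {g u u' : π.ker} (hu : (g : G) = u) (hu' : u' = g⁻¹)
    (h : (u : G) * u' = 1) (h' : (u' : G) * g = 1) (φ : ρ.Tr g) (x : V) :
    (ρ.cap h x).inv ≫ ρ.actMap u (ρ.actMap u' (ρ.ev φ x) ≫ (ρ.cap h' x).hom) =
      (α.val g (g : G)⁻¹ g : k) • (ρ.ev φ x ≫ (castIso ρ.F hu rfl).hom) := by
  obtain rfl : g = u := Subtype.ext hu
  subst hu'
  have hz := ρ.zigzag h h' x
  have hn := ρ.actMap_actMap_cap h (ρ.ev φ x)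
  rw [actMap_comp, actMap_iso, hz, Linear.comp_smul, hn, Linear.comp_smul, Iso.inv_hom_id_assoc]
  simp [castIso]

/-- Contracting with `ρ(u)` exchanges the two signs of a twist. From `ε = 1` this is the definition
of the dual of `φ`; from `ε = -1` it is the double dual, which costs a scalar. -/
lemma push_signTwist_cap {ε γ : ℤˣ} (hγ : γ = -ε) {g u u' : π.ker} (hu : u = g ^ (γ : ℤ))
    (hu' : u' = g ^ (ε : ℤ)) (h : (u : G) * u' = 1) (hs : ε = ε * π (u : G)) (φ : ρ.Tr g) (x : V) :
    Signed.push (ρ.F u) hs (ρ.signTwist ε hu' φ x) ≫ (Signed.iso ε (ρ.cap h x)).hom =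
      ((if ε = -1 then α.val g (g : G)⁻¹ g else 1 : kˣ) : k) •
        Signed.flip hγ (ρ.signTwist γ hu φ x) := by
  rw [push_ker]
  ext h'
  · have e : ε ≠ -1 := by rw [h']; decide
    have hgu : (g : G) = u' := by simp [hu', h']
    simp only [e, if_false, Units.val_one, one_smul]
    exact ρ.cast_cap hgu (hgu ▸ h) x (ρ.ev φ x)
  · simp only [h', if_true]
    exact ρ.inv_cap_actMap_opposite (by simp [hu, hγ, h']) (by simp [hu', h']) h _ φ x

/-- Computes the dual of `β_a(φ)` from the opposite twist of `φ`, as needed when the second map has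
degree `-1`. Associativity for `(w, a, u')`, `(w, g₁, a)` and `(a, u, u')` produces the fraction
that the transgression raises to the power `(π(ω₂) - 1) / 2`. -/
lemma actMap_slide_cap {a m : G} {g g₁ w u u' : π.ker} {γ : ℤˣ}
    (h : a * ↑(g ^ (π a : ℤ)) = ↑g₁ * a) (hu' : u' = g ^ (π a : ℤ)) (hγ : γ = -π a)
    (hu : u = g ^ (γ : ℤ)) (hw : (w : G) * g₁ = 1) (hm : a * u = m) (hm' : w * a = m)
    (φ : ρ.Tr g) (y : V) :
    ρ.actMap w (ρ.slide h φ y) ≫ (ρ.cap hw ((ρ.F a).obj ⟨y⟩)).hom =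
      (((if π a = -1 then α.val g (g : G)⁻¹ g else 1) *
        (α.val w g₁ a * α.val a u u' / α.val w a u')⁻¹ : kˣ) : k) •
        ((ρ.mu hm' y).hom ≫ (ρ.mu hm y).inv ≫
          (ρ.F a).map (Signed.flip hγ (ρ.signTwist γ hu φ y))) := by
  have huu : (u : G) * u' = 1 := by
    rw [hu, hu', hγ]; push_cast; rw [← zpow_add, neg_add_cancel, zpow_zero]
  have hq : (a * u' : G) = g₁ * a := by rw [hu', h]
  have hwq : (w : G) * (g₁ * a) = a := by rw [← mul_assoc, hw, one_mul]
  have hmu : m * u' = a := by rw [← hm, mul_assoc, huu, mul_one]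
  have J1 := ρ.mu_assoc hm' hq hmu hwq y
  have J2 := ρ.mu_assoc hw (rfl : (g₁ : G) * a = _) (one_mul a) hwq y
  have J3 := ρ.mu_assoc hm huu hmu (mul_one a) y
  have hcap : ((ρ.mu hw ((ρ.F a).obj ⟨y⟩)).hom ≫ (ρ.mu (one_mul a) y).hom) =
      (ρ.cap hw ((ρ.F a).obj ⟨y⟩)).hom := by rw [cap_eq, mu_one_left]; rfl
  rw [hcap] at J2
  rw [mu_one_right, ← Functor.map_comp, iso_trans_hom, ← cap_eq] at J3
  have hs : π a = π a * π (u : G) := sign_coe a u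
  have hT := ρ.push_signTwist_cap hγ hu hu' huu hs φ y
  have hT' := congrArg (ρ.F a).map hT
  rw [Functor.map_comp, J3, Functor.map_smul] at hT'
  have hma : π a = π m := by rw [← hm, map_mul, ← hs]
  have hn1 := ρ.mu_nat hm hs hma (ρ.signTwist (π a) hu' φ y)
  have hwa : π a = π (w : G) * π a := by rw [MonoidHom.mem_ker.mp w.2, one_mul]
  have hn2 := ρ.mu_nat hm' hwa hma (ρ.signTwist (π a) hu' φ y)
  rw [← actMap_iso] at J1 J2
  rw [← actMap_map] at hn2
  have J2' : ρ.actMap w (ρ.mu (rfl : (g₁ : G) * a = _) y).inv ≫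
      (ρ.cap hw ((ρ.F a).obj ⟨y⟩)).hom = ((α.val w g₁ a)⁻¹ : kˣ) • (ρ.mu hwq y).hom := by
    rw [Units.smul_def, eq_units_inv_smul J2, Linear.comp_smul, ← Category.assoc, ← actMap_comp,
      Iso.inv_hom_id, actMap_id, Category.id_comp]
  have hn3 : (ρ.F m).map (Signed.recast hma (ρ.signTwist (π a) hu' φ y)) =
      (ρ.mu hm y).inv ≫ (ρ.F a).map (Signed.push (ρ.F u) hs (ρ.signTwist (π a) hu' φ y)) ≫
        (ρ.mu hm ((ρ.F u').obj ⟨y⟩)).hom := by rw [hn1, Iso.inv_hom_id_assoc]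
  rw [Linear.comp_smul] at hT'
  rw [ρ.slide_eq h hu' hq rfl, actMap_comp, actMap_comp, Category.assoc, Category.assoc, J2',
    Units.smul_def, Linear.comp_smul, J1, Linear.comp_smul, Linear.comp_smul, reassoc_of% hn2, hn3]
  simp only [Category.assoc]
  rw [eq_units_inv_smul hT'.symm, Linear.comp_smul, Linear.comp_smul]
  simp only [Linear.comp_smul, smul_smul, ← Units.val_mul]
  congr 2
  simp only [div_eq_mul_inv, mul_inv_rev, inv_inv]
  ac_rfl

/-- The scalar that compares the twist of `β_{g, a}(φ)` with the twist of `φ`. -/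
def _root_.Real2.TwistedCocycle.twistCoeff (α : TwistedCocycle π k) (δ : ℤˣ) (a g : G) : kˣ :=
  (if δ = -1 ∧ π a = -1 then α.val g g⁻¹ g else 1) *
  (α.val (a * g ^ (-π a : ℤ) * a⁻¹) (a * g ^ (π a : ℤ) * a⁻¹) a *
      α.val a (g ^ (-π a : ℤ)) (g ^ (π a : ℤ)) /
      α.val (a * g ^ (-π a : ℤ) * a⁻¹) a (g ^ (π a : ℤ))) ^ (((δ : ℤ) - 1) / 2)

/-- For `δ = 1` this is the slide formula `ev_beta_comp` without any scalar; for `δ = -1` it is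
`actMap_slide_cap`. In `beta_beta` it replaces the twist inside the outer slide. -/
lemma signTwist_beta {δ γ : ℤˣ} {a m : G} {g g₁ w u : π.ker} (hγ : γ = δ * π a)
    (h : a * ↑(g ^ (π a : ℤ)) = ↑g₁ * a) (hw : w = g₁ ^ (δ : ℤ)) (hu : u = g ^ (γ : ℤ))
    (hm : a * u = m) (hm' : w * a = m) (φ : ρ.Tr g) (y : V) :
    ρ.signTwist δ hw (ρ.beta h φ) ((ρ.F a).obj ⟨y⟩) =
      (α.twistCoeff δ a g : k) • (Signed.push (ρ.F a) hγ (ρ.signTwist γ hu φ y) ≫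
        (Signed.iso δ (ρ.mu hm y ≪≫ (ρ.mu hm' y).symm)).hom) := by
  have hg₁ : (g₁ : G) = a * g ^ (π a : ℤ) * a⁻¹ := by
    rw [eq_mul_inv_iff_mul_eq, ← h]; rfl
  have hg₁' : (g₁ : G)⁻¹ = a * g ^ (-π a : ℤ) * a⁻¹ := by
    rw [hg₁]; group
  ext hδ
  · have hd : α.twistCoeff δ a g = 1 := by
      simp [TwistedCocycle.twistCoeff, hδ, show (1 : ℤˣ) ≠ -1 by decide]
    have hwg : w = g₁ := by simp [hw, hδ]
    have hγa : γ = π a := by rw [hγ, hδ, one_mul]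
    subst hwg hγa
    rw [hd, Units.val_one, one_smul]
    have hs := ρ.slide_eq h hu hm hm' φ y
    rw [← ev_beta_comp] at hs
    refine Eq.trans ?_ hs
    simp [signTwist, castIso]
  · have hwg : (w : G) * g₁ = 1 := by simp [hw, hδ]
    have hwg' : (w : G) = (g₁ : G)⁻¹ := by simp [hw, hδ]
    have hγa : γ = - π a := by rw [hγ, hδ, neg_one_mul]
    have hs := ρ.actMap_slide_cap h rfl hγa hu hwg hm hm' φ y
    rw [← ev_beta_comp] at hs
    refine hs.trans ?_
    have hd : α.twistCoeff δ a g = (if π a = -1 then α.val g (g : G)⁻¹ g else 1) *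
        (α.val w g₁ a * α.val a u ↑(g ^ (π a : ℤ)) / α.val w a ↑(g ^ (π a : ℤ)))⁻¹ := by
      have hu' : (u : G) = g ^ (-π a : ℤ) := by rw [hu, hγa]; rfl
      rw [TwistedCocycle.twistCoeff, hwg', hg₁', hg₁, hu', hδ]
      simp
    rw [hd]
    simp only [Signed.hom_smul_neg, Signed.comp_neg]
    refine congrArg (_ • ·) ?_
    exact (Category.assoc _ _ _).symm

/-- Separates the part of the transgression caused by dualizing from the three factors that occur
already for the ungraded loop transgression. -/
lemma tauRef_eq (α : TwistedCocycle π k) {a b : G} {g g₂ u w : G}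
    (hu : u = g ^ (π (b * a) : ℤ)) (hw : w * a = a * u) (h₂ : g₂ * (b * a) = b * a * u) :
    α.tauRef b a g = α.twistCoeff (π b) a g * (α.val b a u * α.val g₂ b a / α.val b w a) := by
  rw [TwistedCocycle.tauRef, TwistedCocycle.twistCoeff, ← hu, ← hw, ← h₂, mul_inv_cancel_right,
    mul_inv_cancel_right]

lemma beta_beta {a b : G} {g g₁ g₂ : π.ker} (h₁ : a * ↑(g ^ (π a : ℤ)) = ↑g₁ * a)
    (h₂ : b * ↑(g₁ ^ (π b : ℤ)) = ↑g₂ * b)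
    (h : b * a * ↑(g ^ (π (b * a) : ℤ)) = ↑g₂ * (b * a)) (φ : ρ.Tr g) :
    ρ.beta h₂ (ρ.beta h₁ φ) = (α.tauRef b a g : k) • ρ.beta h φ := by
  obtain ⟨u, hu⟩ : ∃ u : π.ker, u = g ^ (π (b * a) : ℤ) := ⟨_, rfl⟩
  obtain ⟨w, hw⟩ : ∃ w : π.ker, w = g₁ ^ (π b : ℤ) := ⟨_, rfl⟩
  have hbw : b * w = g₂ * b := by rw [hw, h₂]
  have hgp : b * a * u = g₂ * (b * a) := by rw [hu, h]
  have hwa : w * a = a * u := by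
    apply mul_left_cancel (a := b)
    rw [← mul_assoc, hbw, mul_assoc, ← hgp, mul_assoc]
  have hτ := tauRef_eq α (b := b) (u := u) (w := w) (g₂ := g₂) (g := g) (a := a)
    (by rw [hu]; rfl) hwa hgp.symm
  -- On `ρ(ba) y`, which is isomorphic to `ρ(b) ρ(a) y`, all three maps `β` become slides. Below,
  -- `I1`, `I2` and `I3` supply the factors `α(b, a, u)`, `α(b, w, a)⁻¹` and `α(g₂, b, a)`.
  refine ρ.Tr_ext_of_essSurj (ρ.F (b * a)) fun ⟨y⟩ => ?_
  have hb : b * (a * u) = g₂ * (b * a) := by rw [← mul_assoc, hgp]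
  have I1 := ρ.mu_assoc (rfl : b * a = _) (rfl : a * u = _) hgp hb y
  have I2 := ρ.mu_assoc hbw hwa (mul_assoc _ _ _) hb y
  have I3 := ρ.mu_assoc (rfl : (g₂ : G) * b = _) (rfl : b * a = _) (mul_assoc _ _ _) rfl y
  have hn := ρ.mu_nat (rfl : b * a = _) (π.map_mul b a) rfl (ρ.signTwist (π (b * a)) hu φ y)
  rw [ev_smul, ev_beta_comp, ρ.slide_eq h hu hgp rfl,
    ρ.ev_iso _ (ρ.mu (rfl : b * a = _) y), ev_beta_comp, ρ.slide_eq h₂ hw hbw rfl,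
    ρ.signTwist_beta (π.map_mul b a) h₁ hw hu rfl hwa, Functor.map_smul, Functor.map_comp, hτ,
    ← iso_trans_hom, Functor.map_comp]
  rw [← actMap_iso] at I3
  have h3 : (ρ.mu (rfl : (g₂ : G) * b = _) ((ρ.F a).obj ⟨y⟩)).inv ≫
      ρ.actMap g₂ (ρ.mu (rfl : b * a = _) y).hom = (α.val g₂ b a : k) •
        ((ρ.mu (mul_assoc _ _ _) y).hom ≫ (ρ.mu (rfl : (g₂ : G) * (b * a) = _) y).inv) := by
    rw [Iso.inv_comp_eq, Linear.comp_smul, ← Category.assoc, ← Linear.smul_comp, ← I3,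
      Category.assoc, Iso.hom_inv_id, Category.comp_id]
  have h2 : (ρ.F b).map (Signed.iso (π b) (ρ.mu hwa y).symm).hom ≫
      (ρ.mu hbw ((ρ.F a).obj ⟨y⟩)).hom ≫ (ρ.mu (mul_assoc _ _ _) y).hom =
        (((α.val b w a)⁻¹ : kˣ) : k) • (ρ.mu hb y).hom := by
    rw [eq_units_inv_smul I2, Linear.comp_smul, ← Category.assoc, ← Functor.map_comp,
      iso_trans_hom, Iso.symm_self_id]
    exact congrArg (_ • ·) ((congrArg (· ≫ _) ((ρ.F b).map_id _)).trans (Category.id_comp _))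
  simp only [Category.assoc, Linear.smul_comp, Linear.comp_smul] at hn ⊢
  rw [h3]
  simp only [Linear.comp_smul]
  rw [reassoc_of% h2]
  simp only [Linear.smul_comp, Linear.comp_smul]
  rw [reassoc_of% I1]
  simp only [Linear.smul_comp, Linear.comp_smul, Category.assoc]
  rw [reassoc_of% hn, Iso.inv_hom_id_assoc]
  simp only [smul_smul, ← Units.val_mul]
  have hr : Signed.recast rfl (ρ.signTwist (π (b * a)) hu φ y) =
    ρ.signTwist (π (b * a)) hu φ y := rfl
  rw [hr]
  congr 2
  rw [div_eq_mul_inv]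
  ac_rfl

lemma signTwist_one {ε : ℤˣ} (hε : ε = 1) {g : π.ker} (hu : g = g ^ (ε : ℤ)) (φ : ρ.Tr g) (x : V) :
    ρ.signTwist ε hu φ x = Signed.ofOne hε (ρ.ev φ x) := by
  ext h
  · simp [signTwist, castIso]
  · exact absurd (hε.symm.trans h) (by decide)

/-- On the image of `ρ(1)` the unit laws turn both multiplications of the slide into `ψ_e`, and the
naturality of `ψ_e` and of `φ` finishes. -/
lemma beta_one {g : π.ker} (h : 1 * ↑(g ^ (π 1 : ℤ)) = ↑g * (1 : G)) (φ : ρ.Tr g) :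
    ρ.beta h φ = φ := by
  have hu : g = g ^ ((π 1 : ℤˣ) : ℤ) := by simp
  refine ρ.Tr_ext_of_essSurj (ρ.F 1) fun ⟨y⟩ => ?_
  rw [ev_beta_comp, ρ.slide_eq h hu (one_mul _) (mul_one _), signTwist_one _ π.map_one,
    mu_one_left, ← Category.assoc, ρ.ψe_nat, Category.assoc, ← Category.assoc, Iso.comp_inv_eq,
    mu_one_right, ← actMap_iso, ev_naturality]

lemma beta_comp {a b : G} {g g₁ g₂ : π.ker} (h₁ : a * ↑(g ^ (π a : ℤ)) = ↑g₁ * a)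
    (h₂ : b * ↑(g₁ ^ (π b : ℤ)) = ↑g₂ * b)
    (h : b * a * ↑(g ^ (π (b * a) : ℤ)) = ↑g₂ * (b * a)) :
    ρ.beta h₂ ∘ₗ ρ.beta h₁ = (α.tauRef b a g : k) • ρ.beta h :=
  LinearMap.ext (ρ.beta_beta h₁ h₂ h)

lemma beta_congr {ω ω' : G} (hω : ω = ω') {g g' : π.ker} (h : ω * ↑(g ^ (π ω : ℤ)) = ↑g' * ω)
    (h' : ω' * ↑(g ^ (π ω' : ℤ)) = ↑g' * ω') : ρ.beta h = ρ.beta h' := by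
  subst hω; rfl

lemma conj_rel (p : GComm π) (σ : G) : σ * ↑(p.g ^ (π σ : ℤ)) = ↑(p.conj σ).g * σ := by
  simp [GComm.conj]

lemma conj_rel_inv (p : GComm π) (σ : G) :
    σ⁻¹ * ↑((p.conj σ).g ^ (π σ⁻¹ : ℤ)) = ↑p.g * σ⁻¹ := by
  rcases Int.units_eq_one_or (π σ) with h | h <;> simp [GComm.conj, h, mul_assoc]

/-- The maps `β_σ` and `β_{σ⁻¹}` are inverse to each other, up to a scalar. -/
lemma beta_inv_comp {σ τ : G} (hσ : τ * σ = 1) {g g' : π.ker}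
    (h : σ * ↑(g ^ (π σ : ℤ)) = ↑g' * σ) (h' : τ * ↑(g' ^ (π τ : ℤ)) = ↑g * τ) :
    ρ.beta h' ∘ₗ ρ.beta h = (α.tauRef τ σ g : k) • LinearMap.id := by
  rw [ρ.beta_comp h h' (by simp [hσ])]
  congr 1
  ext1 φ
  rw [ρ.beta_congr hσ _ (by simp)]
  exact ρ.beta_one _ φ

lemma beta_bijective (p : GComm π) (σ : G) : Function.Bijective (ρ.beta (conj_rel p σ)) := by
  have h₁ := ρ.beta_inv_comp (inv_mul_cancel σ) (conj_rel p σ) (conj_rel_inv p σ)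
  have h₂ := ρ.beta_inv_comp (mul_inv_cancel σ) (conj_rel_inv p σ) (conj_rel p σ)
  constructor
  · refine Function.LeftInverse.injective
      (g := fun θ => ((α.tauRef σ⁻¹ σ p.g)⁻¹ : kˣ) • ρ.beta (conj_rel_inv p σ) θ) fun φ => ?_
    have h : ρ.beta _ (ρ.beta _ φ) = (α.tauRef σ⁻¹ σ p.g : k) • φ := LinearMap.congr_fun h₁ φ
    exact (eq_units_inv_smul h).symm
  · refine fun θ => ⟨((α.tauRef σ σ⁻¹ (p.conj σ).g)⁻¹ : kˣ) • ρ.beta (conj_rel_inv p σ) θ, ?_⟩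
    have h : ρ.beta _ (ρ.beta _ θ) = (α.tauRef σ σ⁻¹ (p.conj σ).g : k) • θ :=
      LinearMap.congr_fun h₂ θ
    rw [Units.smul_def, map_smul]
    exact (eq_units_inv_smul h).symm

/-- Both sides are multiples of `β_{σω}`, because `σω = (σωσ⁻¹)σ`. The ratio of the two
transgression factors is the iterated transgression. -/
lemma beta_conj_comp (p : GComm π) (σ : G) :
    ρ.beta (p.conj σ).comm ∘ₗ ρ.beta (conj_rel p σ) =
      (α.tautau σ p : k) • (ρ.beta (conj_rel p σ) ∘ₗ ρ.beta p.comm) := by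
  have e : σ * p.ω * ↑(p.g ^ (π (σ * p.ω) : ℤ)) = ↑(p.conj σ).g * (σ * p.ω) := by
    have h1 := conj_rel p σ
    have h2 := SemiconjBy.zpow_right (a := p.ω) p.comm (π σ : ℤ)
    have h3 := h2.eq
    push_cast at h1 h3 ⊢
    rw [← mul_assoc (p.conj σ).g.1, ← h1, mul_assoc, mul_assoc, ← h3, map_mul, Units.val_mul,
      mul_comm (π σ : ℤ), zpow_mul]
  have e' : (p.conj σ).ω * σ = σ * p.ω := by simp [GComm.conj]
  rw [ρ.beta_comp (conj_rel p σ) (p.conj σ).comm (by rw [e']; exact e),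
    ρ.beta_comp p.comm (conj_rel p σ) e, ρ.beta_congr e' _ e, smul_smul, ← Units.val_mul]
  congr 2
  rw [TwistedCocycle.tautau, div_mul_cancel]
  rfl

end TwistedRep
end Composition
-- Natural endomorphisms of the identity and the blocks of the categorical trace
section Center

/-- An endomorphism of `x`, read as an endomorphism in `^ε C`. -/
@[simps]
def Signed.endo (ε : ℤˣ) {C : Type*} [Category* C] {x : C} (f : x ⟶ x) :
    (⟨x⟩ : Signed ε C) ⟶ ⟨x⟩ where
  pos _ := f
  neg _ := f

namespace TwistedRep

variable {G : Type*} [Group G] {π : G →* ℤˣ} {k : Type*} [CommRing k] {α : TwistedCocycle π k}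
  {V : Type*} [Category* V] [Preadditive V] [Linear k V] (ρ : TwistedRep α V)

/-- The action of the endomorphisms of the identity functor on the categorical trace. -/
def centerAct (z : 𝟭 V ⟶ 𝟭 V) (g : π.ker) : ρ.Tr g →ₗ[k] ρ.Tr g where
  toFun φ := z ≫ φ
  map_add' _ _ := Preadditive.comp_add _ _ _ _ _ _
  map_smul' _ _ := Linear.comp_smul _ _ _ _ _ _

lemma ev_centerAct (z : 𝟭 V ⟶ 𝟭 V) {g : π.ker} (φ : ρ.Tr g) (x : V) :
    ρ.ev (ρ.centerAct z g φ) x = z.app x ≫ ρ.ev φ x := rfl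

/-- Naturality of `φ` moves `z` from its source to its target, where `ρ(g)` turns it into `z'`;
naturality of `z'` brings it back to the source. -/
lemma ev_centerAct_of_map {z z' : 𝟭 V ⟶ 𝟭 V} {g : π.ker}
    (hz : ∀ x, ρ.actMap g (z.app x) = z'.app ((ρ.F g).obj ⟨x⟩)) (φ : ρ.Tr g) :
    ρ.centerAct z g φ = ρ.centerAct z' g φ := by
  refine ρ.Tr_ext fun x => ?_
  rw [ev_centerAct, ev_centerAct]
  exact (ρ.ev_naturality φ (z.app x)).trans ((congrArg (_ ≫ ·) (hz x)).trans
    (z'.naturality (ρ.ev φ x)))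

lemma twist_centerAct (ω : G) (z : 𝟭 V ⟶ 𝟭 V) {g : π.ker} (φ : ρ.Tr g) (x : V) :
    ρ.twist ω (ρ.centerAct z g φ) x = Signed.endo (π ω) (z.app x) ≫ ρ.twist ω φ x := by
  ext h
  · exact Category.assoc _ _ _
  · have h1 := ρ.ev_naturality φ (z.app x)
    have h2 := ρ.actMap_actMap_cap (u := g⁻¹) (u' := g) (by simp) (z.app x)
    simp only [twist, ev_centerAct, Signed.comp_neg, Signed.endo_neg, Category.assoc]
    refine congrArg (_ ≫ ·) ?_
    erw [h1]
    rw [actMap_comp, Category.assoc]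
    exact congrArg (_ ≫ ·) h2

/-- In a slide, `z` stands in front of the twist and under `ρ(ω)`, so it leaves the slide as `z'`.
-/
lemma beta_centerAct {ω : G} {z z' : 𝟭 V ⟶ 𝟭 V}
    (hz : ∀ x, (ρ.F ω).map (Signed.endo (π ω) (z.app x)) = z'.app ((ρ.F ω).obj ⟨x⟩))
    {g g' : π.ker} (h : ω * ↑(g ^ (π ω : ℤ)) = ↑g' * ω) (φ : ρ.Tr g) :
    ρ.beta h (ρ.centerAct z g φ) = ρ.centerAct z' g' (ρ.beta h φ) := by
  refine ρ.Tr_ext_of_essSurj (ρ.F ω) fun ⟨y⟩ => ?_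
  rw [ev_beta_comp, ev_centerAct, ev_beta_comp, slide, slide, twist_centerAct, Functor.map_comp,
    Category.assoc]
  exact congrArg (· ≫ _) (hz y)

end TwistedRep

namespace SProd

variable {ι : Type*} {ε : ι → ℤˣ} {V : Type*} [Category* V] [Preadditive V]

open Classical in
/-- The projection onto the factor `j`, as an endomorphism of the identity functor. -/
noncomputable def proj (j : ι) : 𝟭 (SProd ε V) ⟶ 𝟭 (SProd ε V) where
  app x := ⟨fun i => if i = j then 𝟙 _ else 0⟩
  naturality x y f := hom_ext fun i => by
    by_cases h : i = j <;> simp [h]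

lemma proj_app_self (j : ι) (x : SProd ε V) : ((proj j).app x).app j = 𝟙 _ := if_pos rfl

lemma proj_app_of_ne {i j : ι} (h : i ≠ j) (x : SProd ε V) : ((proj j).app x).app i = 0 :=
  if_neg h

lemma proj_comp_of_ne {i j : ι} (h : i ≠ j) : proj (ε := ε) (V := V) i ≫ proj j = 0 := by
  ext x
  refine hom_ext fun l => ?_
  by_cases hl : l = j
  · subst hl
    refine (congrArg (· ≫ _) (proj_app_of_ne h.symm x)).trans ?_
    exact Limits.zero_comp
  · exact (congrArg (_ ≫ ·) (proj_app_of_ne hl x)).trans Limits.comp_zero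

lemma proj_comp_self (j : ι) : proj (ε := ε) (V := V) j ≫ proj j = proj j := by
  ext x
  refine hom_ext fun l => ?_
  by_cases hl : l = j
  · subst hl
    exact (congrArg (· ≫ _) (proj_app_self l x)).trans (Category.id_comp _)
  · exact (congrArg (_ ≫ ·) (proj_app_of_ne hl x)).trans
      (Limits.comp_zero.trans (proj_app_of_ne hl x).symm)

lemma coord_proj {γ δ : ℤˣ} (j : ι) (x : SProd ε V) (i : ι) (h : γ = δ * ε i) :
    (i = j → coord (Signed.endo δ ((proj j).app x)) i h = 𝟙 _) ∧
    (i ≠ j → coord (Signed.endo δ ((proj j).app x)) i h = 0) := by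
  constructor
  · rintro rfl
    refine Eq.trans ?_ (coord_id (x := x) i h)
    unfold coord
    split_ifs <;> simp only [Signed.endo, proj_app_self] <;> rfl
  · intro hij
    unfold coord
    split_ifs <;> simp only [Signed.endo, proj_app_of_ne hij] <;> rfl

end SProd

namespace RInd

variable {G : Type*} [Group G] {π : G →* ℤˣ} {H : Subgroup G} {k : Type*} [CommRing k]
  {α : TwistedCocycle π k} {V : Type*} [Category* V] [Preadditive V] [Linear k V]
  (ρ : TwistedRep (α.res H) V) (S : CosetReps H)

/-- Entry `i` of the matrix of `ω` reads the factor `ω⁻¹ i`, which is `j` exactly for `i = ωj`. -/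
lemma F_map_proj (ω : G) (j : G ⧸ H) (x : Cat π S V) :
    (F ρ S ω).map (Signed.endo (π ω) ((SProd.proj j).app x)) =
      (SProd.proj (ω • j)).app ((F ρ S ω).obj ⟨x⟩) := by
  refine SProd.hom_ext fun i => ?_
  rw [F_map_app]
  by_cases h : i = ω • j
  · subst h
    rw [SProd.proj_app_self, (SProd.coord_proj j x _ rfl).1 (inv_smul_smul ω j)]
    exact Signed.push_id _ _ _
  · rw [SProd.proj_app_of_ne h, (SProd.coord_proj j x _ rfl).2 (mt inv_smul_eq_iff.mp h)]
    have := Signed.push_smul (ρ.F (S.eta ω i)) (S.sign π ω i) (0 : k) (0 :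
      (⟨x.of (ω⁻¹ • i)⟩ : Signed (π ω * π (S.s (ω⁻¹ • i))) V) ⟶ ⟨x.of (ω⁻¹ • i)⟩)
    rw [smul_zero, zero_smul] at this
    exact this

/-- The projection of the categorical trace onto the factor `j`. -/
noncomputable def block (g : π.ker) (j : G ⧸ H) :
    (RInd ρ S).Tr g →ₗ[k] (RInd ρ S).Tr g :=
  (RInd ρ S).centerAct (SProd.proj j) g

lemma beta_block {ω : G} {g g' : π.ker} (h : ω * ↑(g ^ (π ω : ℤ)) = ↑g' * ω) (j : G ⧸ H) :
    (RInd ρ S).beta h ∘ₗ block ρ S g j = block ρ S g' (ω • j) ∘ₗ (RInd ρ S).beta h :=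
  LinearMap.ext fun φ => (RInd ρ S).beta_centerAct (F_map_proj ρ S ω j) h φ

lemma block_comp_self (g : π.ker) (j : G ⧸ H) :
    block ρ S g j ∘ₗ block ρ S g j = block ρ S g j :=
  LinearMap.ext fun φ => (Category.assoc _ _ _).symm.trans
    (congrArg (· ≫ φ) (SProd.proj_comp_self j))

lemma block_comp_of_ne (g : π.ker) {i j : G ⧸ H} (h : i ≠ j) :
    block ρ S g i ∘ₗ block ρ S g j = 0 :=
  LinearMap.ext fun φ => (Category.assoc _ _ _).symm.trans
    ((congrArg (· ≫ φ) (SProd.proj_comp_of_ne h)).trans Limits.zero_comp)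

lemma block_smul (g : π.ker) (j : G ⧸ H) : block ρ S g j = block ρ S g ((g : G) • j) := by
  refine LinearMap.ext fun φ => (RInd ρ S).ev_centerAct_of_map (fun x => ?_) φ
  refine Eq.trans (congrArg (F ρ S g).map ?_) (F_map_proj ρ S g j x)
  ext h <;> [rfl; exact absurd h (TwistedRep.ker_ne _)]

/-- The block is idempotent and coincides with the block of `gj`, to which it is orthogonal. -/
lemma block_eq_zero (g : π.ker) {j : G ⧸ H} (h : (g : G) • j ≠ j) : block ρ S g j = 0 := by
  rw [← block_comp_self]
  nth_rewrite 1 [block_smul]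
  exact block_comp_of_ne ρ S g h

lemma sum_block [Fintype (G ⧸ H)] (g : π.ker) : ∑ j, block ρ S g j = LinearMap.id := by
  classical
  refine LinearMap.ext fun φ => (RInd ρ S).Tr_ext fun x => SProd.hom_ext fun i => ?_
  rw [LinearMap.sum_apply]
  have hsum : ∀ s : Finset (G ⧸ H), ((RInd ρ S).ev (∑ j ∈ s, block ρ S g j φ) x).app i =
      ∑ j ∈ s, ((RInd ρ S).ev (block ρ S g j φ) x).app i := by
    intro s
    induction s using Finset.induction_on with
    | empty => rfl
    | insert a s ha ih => rw [Finset.sum_insert ha, Finset.sum_insert ha, ← ih]; rfl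
  rw [hsum, Finset.sum_eq_single i]
  · exact (congrArg (· ≫ _) (SProd.proj_app_self i x)).trans (Category.id_comp _)
  · intro j _ hj
    exact (congrArg (· ≫ _) (SProd.proj_app_of_ne hj.symm x)).trans Limits.zero_comp
  · simp

end RInd
end Center
-- Intertwiners and the maps of categorical traces that they induce
/-- The functor `^ε P`, on morphisms. -/
@[simps]
def Signed.mapHom {ε : ℤˣ} {C D : Type*} [Category* C] [Category* D] (P : C ⥤ D) {x y : C}
    (f : (⟨x⟩ : Signed ε C) ⟶ ⟨y⟩) : (⟨P.obj x⟩ : Signed ε D) ⟶ ⟨P.obj y⟩ where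
  pos h := P.map (f.pos h)
  neg h := P.map (f.neg h)

section Intertwiner

variable {G : Type*} [Group G] {π : G →* ℤˣ} {k : Type*} [CommRing k] {α : TwistedCocycle π k}
  {W : Type*} [Category* W] [Preadditive W] [Linear k W]
  {V : Type*} [Category* V] [Preadditive V] [Linear k V]

/-- The restriction of a twisted Real `2`-representation to a subgroup. -/
@[simps]
def TwistedRep.res (ρ : TwistedRep α V) (H : Subgroup G) : TwistedRep (α.res H) V where
  F ω := ρ.F ω
  additive ω := ρ.additive ω
  linear ω := ρ.linear ω
  ψ ω₂ ω₁ x := ρ.ψ ω₂ ω₁ x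
  ψ_nat ω₂ ω₁ _ _ f := ρ.ψ_nat ω₂ ω₁ f
  ψe x := ρ.ψe x
  ψe_nat f := ρ.ψe_nat f
  assoc ω₃ ω₂ ω₁ x := ρ.assoc ω₃ ω₂ ω₁ x
  unit_left ω x := ρ.unit_left ω x
  unit_right ω x := ρ.unit_right ω x

/-- A `1`-morphism of twisted Real `2`-representations which is compatible with the actions up to
coherent isomorphism. -/
structure Intertwiner (ρ₁ : TwistedRep α W) (ρ₂ : TwistedRep α V) where
  /-- the underlying functor -/
  P : W ⥤ V
  /-- the compatibility isomorphisms -/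
  κ : ∀ (ω : G) (x : W), P.obj ((ρ₁.F ω).obj ⟨x⟩) ≅ (ρ₂.F ω).obj ⟨P.obj x⟩
  κ_nat : ∀ (ω : G) {x y : W} (f : (⟨x⟩ : Signed (π ω) W) ⟶ ⟨y⟩),
    P.map ((ρ₁.F ω).map f) ≫ (κ ω y).hom = (κ ω x).hom ≫ (ρ₂.F ω).map (Signed.mapHom P f)
  κ_mul : ∀ (b a : G) (x : W), P.map (ρ₁.ψ b a x).hom ≫ (κ (b * a) x).hom =
    (κ b ((ρ₁.F a).obj ⟨x⟩)).hom ≫ (ρ₂.F b).map (Signed.iso (π b) (κ a x)).hom ≫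
      (ρ₂.ψ b a (P.obj x)).hom
  κ_one : ∀ x : W, P.map (ρ₁.ψe x).hom = (κ 1 x).hom ≫ (ρ₂.ψe (P.obj x)).hom

namespace Intertwiner

variable {ρ₁ : TwistedRep α W} {ρ₂ : TwistedRep α V} (Φ : Intertwiner ρ₁ ρ₂)

lemma κ_cast {a b : G} (h : a = b) (x : W) :
    Φ.P.map (castIso ρ₁.F h rfl).hom ≫ (Φ.κ b x).hom =
      (Φ.κ a x).hom ≫ (castIso ρ₂.F h rfl).hom := by
  subst h; simp [castIso]

lemma κ_mu {a b c : G} (h : b * a = c) (x : W) :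
    Φ.P.map (ρ₁.mu h x).hom ≫ (Φ.κ c x).hom =
      (Φ.κ b ((ρ₁.F a).obj ⟨x⟩)).hom ≫ (ρ₂.F b).map (Signed.iso (π b) (Φ.κ a x)).hom ≫
        (ρ₂.mu h (Φ.P.obj x)).hom := by
  have h1 := Φ.κ_mul b a x
  have h2 := Φ.κ_cast h x
  simp only [TwistedRep.mu, Iso.trans_hom, Functor.map_comp, Category.assoc]
  rw [h2, reassoc_of% h1]

lemma κ_cap {a b : G} (h : b * a = 1) (x : W) :
    Φ.P.map (ρ₁.cap h x).hom =
      (Φ.κ b ((ρ₁.F a).obj ⟨x⟩)).hom ≫ (ρ₂.F b).map (Signed.iso (π b) (Φ.κ a x)).hom ≫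
        (ρ₂.cap h (Φ.P.obj x)).hom := by
  have h1 := Φ.κ_mu h x
  rw [TwistedRep.cap_eq, TwistedRep.cap_eq, Iso.trans_hom, Functor.map_comp, κ_one,
    reassoc_of% h1]
  simp

lemma κ_actMap (g : π.ker) {x y : W} (f : x ⟶ y) :
    Φ.P.map (ρ₁.actMap g f) ≫ (Φ.κ g y).hom = (Φ.κ g x).hom ≫ ρ₂.actMap g (Φ.P.map f) := by
  refine (Φ.κ_nat g _).trans (congrArg (_ ≫ ·) (congrArg (ρ₂.F g).map ?_))
  ext h <;> [rfl; exact absurd h (TwistedRep.ker_ne _)]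

/-- The elements `φ` and `θ` of the categorical traces correspond to each other. -/
def Related {g : π.ker} (φ : ρ₁.Tr g) (θ : ρ₂.Tr g) : Prop :=
  ∀ x, Φ.P.map (ρ₁.ev φ x) ≫ (Φ.κ g x).hom = ρ₂.ev θ (Φ.P.obj x)

variable {Φ}

lemma Related.signTwist {g u : π.ker} {φ : ρ₁.Tr g} {θ : ρ₂.Tr g} (h : Φ.Related φ θ) {ε : ℤˣ}
    (hu : u = g ^ (ε : ℤ)) (x : W) :
    Signed.mapHom Φ.P (ρ₁.signTwist ε hu φ x) ≫ (Signed.iso ε (Φ.κ u x)).hom =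
      ρ₂.signTwist ε hu θ (Φ.P.obj x) := by
  ext hε
  · have h1 := Φ.κ_cast (show (g : G) = u by simp [hu, hε]) x
    simp only [Signed.comp_pos, TwistedRep.signTwist, Signed.mapHom_pos, Signed.iso_hom_pos,
      Functor.map_comp, Category.assoc, ← h x]
    rw [h1]
  · have h1 := Φ.κ_actMap u (ρ₁.ev φ x)
    simp only [Signed.comp_neg, TwistedRep.signTwist, Signed.mapHom_neg, Signed.iso_hom_neg,
      Functor.map_comp, κ_cap, ← h x]
    rw [reassoc_of% h1, Iso.inv_hom_id_assoc, TwistedRep.actMap_comp, Category.assoc,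
      TwistedRep.actMap_iso]

lemma Related.slide {ω : G} {g g' : π.ker} {φ : ρ₁.Tr g} {θ : ρ₂.Tr g} (h : Φ.Related φ θ)
    (hω : ω * ↑(g ^ (π ω : ℤ)) = ↑g' * ω) (x : W) :
    Φ.P.map (ρ₁.slide hω φ x) ≫ (Φ.κ g' ((ρ₁.F ω).obj ⟨x⟩)).hom ≫
        ρ₂.actMap g' (Φ.κ ω x).hom = (Φ.κ ω x).hom ≫ ρ₂.slide hω θ (Φ.P.obj x) := by
  have h1 := Φ.κ_mu (rfl : (g' : G) * ω = _) x
  have h2 := Φ.κ_mu hω x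
  have h3 := Φ.κ_nat ω (ρ₁.signTwist (π ω) rfl φ x)
  have h4 := congrArg (ρ₂.F ω).map (h.signTwist rfl x)
  rw [Functor.map_comp] at h4
  rw [← TwistedRep.actMap_iso] at h1
  have h5 : Φ.P.map (ρ₁.mu (rfl : (g' : G) * ω = _) x).inv ≫
      (Φ.κ g' ((ρ₁.F ω).obj ⟨x⟩)).hom ≫ ρ₂.actMap g' (Φ.κ ω x).hom =
        (Φ.κ _ x).hom ≫ (ρ₂.mu (rfl : (g' : G) * ω = _) (Φ.P.obj x)).inv := by
    rw [Iso.eq_comp_inv, Category.assoc, Category.assoc, ← h1, ← Category.assoc,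
      ← Functor.map_comp, Iso.inv_hom_id, CategoryTheory.Functor.map_id, Category.id_comp]
  rw [ρ₁.slide_eq hω rfl hω rfl, ρ₂.slide_eq hω rfl hω rfl]
  simp only [Functor.map_comp, Category.assoc]
  rw [h5, reassoc_of% h2, reassoc_of% h3, reassoc_of% h4]

/-- The slides and caps that make up `β` are built from structure maps which `κ` respects; the two
occurrences of `κ` at `ω⁻¹` cancel by naturality of the slide. -/
lemma Related.beta {ω : G} {g g' : π.ker} {φ : ρ₁.Tr g} {θ : ρ₂.Tr g} (h : Φ.Related φ θ)
    (hω : ω * ↑(g ^ (π ω : ℤ)) = ↑g' * ω) : Φ.Related (ρ₁.beta hω φ) (ρ₂.beta hω θ) := by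
  intro x
  change Φ.P.map (ρ₁.betaApp hω φ x) ≫ _ = ρ₂.betaApp hω θ _
  have h1 := h.slide hω ((ρ₁.F ω⁻¹).obj ⟨x⟩)
  have h2 := Φ.κ_actMap g' (ρ₁.cap (mul_inv_cancel ω) x).hom
  have h3 := Φ.κ_cap (mul_inv_cancel ω) x
  have h4 := ρ₂.slide_naturality hω θ (Signed.iso (π ω) (Φ.κ ω⁻¹ x)).hom
  simp only [TwistedRep.betaApp, Functor.map_comp, Category.assoc]
  rw [h2, h3, TwistedRep.actMap_comp, TwistedRep.actMap_comp, reassoc_of% h1, ← reassoc_of% h4]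
  rw [← cancel_epi (Φ.P.map (ρ₁.cap (mul_inv_cancel ω) x).hom), ← Category.assoc,
    ← Functor.map_comp, Iso.hom_inv_id, CategoryTheory.Functor.map_id, Category.id_comp, h3]
  simp

variable (Φ)

lemma map_ev_eq_zero {g : π.ker} {φ : ρ₁.Tr g} (h : Φ.Related φ 0) (x : W) :
    Φ.P.map (ρ₁.ev φ x) = 0 := by
  rw [← cancel_mono (Φ.κ g x).hom, h x, Limits.zero_comp]
  rfl

lemma map_naturality {g : π.ker} (θ : ρ₂.Tr g) {x y : W} {t : x ⟶ (ρ₁.F g).obj ⟨x⟩}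
    {t' : y ⟶ (ρ₁.F g).obj ⟨y⟩} (ht : Φ.P.map t = ρ₂.ev θ (Φ.P.obj x) ≫ (Φ.κ g x).inv)
    (ht' : Φ.P.map t' = ρ₂.ev θ (Φ.P.obj y) ≫ (Φ.κ g y).inv) (f : x ⟶ y) :
    Φ.P.map (f ≫ t') = Φ.P.map (t ≫ ρ₁.actMap g f) := by
  have h1 := ρ₂.ev_naturality θ (Φ.P.map f)
  have h2 := Φ.κ_actMap g f
  rw [Functor.map_comp, Functor.map_comp, ht, ht', reassoc_of% h1, Category.assoc]
  refine congrArg (_ ≫ ·) ?_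
  rw [Iso.comp_inv_eq, Category.assoc, h2, Iso.inv_hom_id_assoc]

/-- The value of `θ` at `v` is transported along a chosen isomorphism of `v` with an object `P x`.
Fullness lifts every morphism between such objects to `W`, where `φ` is natural. Faithfulness is not
required, which matters as `baseFunctor` forgets all but one factor. -/
lemma exists_related [Φ.P.EssSurj] [Φ.P.Full] {g : π.ker} (φ : ρ₁.Tr g) :
    ∃ θ : ρ₂.Tr g, Φ.Related φ θ := by
  have key : ∀ {x y : W} (f : Φ.P.obj x ⟶ Φ.P.obj y),
      f ≫ Φ.P.map (ρ₁.ev φ y) ≫ (Φ.κ g y).hom =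
        Φ.P.map (ρ₁.ev φ x) ≫ (Φ.κ g x).hom ≫ ρ₂.actMap g f := by
    intro x y f
    obtain ⟨f, rfl⟩ := Φ.P.map_surjective f
    rw [← Category.assoc, ← Functor.map_comp, ρ₁.ev_naturality, Functor.map_comp, Category.assoc,
      κ_actMap]
  let e := fun v => Φ.P.objObjPreimageIso v
  let t : ∀ v, v ⟶ (ρ₂.F g).obj ⟨v⟩ := fun v => (e v).inv ≫
    Φ.P.map (ρ₁.ev φ (Φ.P.objPreimage v)) ≫ (Φ.κ g _).hom ≫ ρ₂.actMap g (e v).hom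
  have ht : ∀ {v v' : V} (f : v ⟶ v'), f ≫ t v' = t v ≫ ρ₂.actMap g f := by
    intro v v' f
    have h := key ((e v).hom ≫ f ≫ (e v').inv)
    have h' := congrArg ((e v).inv ≫ · ≫ ρ₂.actMap g (e v').hom) h
    simp only [Category.assoc, Iso.inv_hom_id_assoc, ← TwistedRep.actMap_comp, Iso.inv_hom_id,
      Category.comp_id] at h'
    simp only [t, Category.assoc, ← TwistedRep.actMap_comp]
    exact h'
  refine ⟨{ app := t, naturality := fun _ _ f => ht f }, fun x => ?_⟩
  have h := key (e (Φ.P.obj x)).hom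
  exact (Iso.eq_inv_comp _).mpr h

/-- The map of categorical traces induced by an intertwiner. -/
noncomputable def trMap [Φ.P.EssSurj] [Φ.P.Full] [Φ.P.Additive] [Φ.P.Linear k] (g : π.ker) :
    ρ₁.Tr g →ₗ[k] ρ₂.Tr g where
  toFun φ := (Φ.exists_related φ).choose
  map_add' φ φ' := ρ₂.Tr_ext_of_essSurj Φ.P fun x => by
    rw [ρ₂.ev_add, ← (Φ.exists_related _).choose_spec, ← (Φ.exists_related _).choose_spec,
      ← (Φ.exists_related _).choose_spec, ρ₁.ev_add, Functor.map_add, Preadditive.add_comp]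
  map_smul' c φ := ρ₂.Tr_ext_of_essSurj Φ.P fun x => by
    rw [RingHom.id_apply, ρ₂.ev_smul, ← (Φ.exists_related _).choose_spec,
      ← (Φ.exists_related _).choose_spec, ρ₁.ev_smul, Functor.map_smul, Linear.smul_comp]

variable [Φ.P.EssSurj] [Φ.P.Full] [Φ.P.Additive] [Φ.P.Linear k]

lemma related_trMap {g : π.ker} (φ : ρ₁.Tr g) : Φ.Related φ (Φ.trMap g φ) :=
  (Φ.exists_related φ).choose_spec

lemma Related.eq_trMap {Φ : Intertwiner ρ₁ ρ₂} [Φ.P.EssSurj] [Φ.P.Full] [Φ.P.Additive]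
    [Φ.P.Linear k] {g : π.ker} {φ : ρ₁.Tr g} {θ : ρ₂.Tr g} (h : Φ.Related φ θ) :
    Φ.trMap g φ = θ :=
  ρ₂.Tr_ext_of_essSurj Φ.P fun x => (Φ.related_trMap φ x).symm.trans (h x)

lemma trMap_beta {ω : G} {g g' : π.ker} (h : ω * ↑(g ^ (π ω : ℤ)) = ↑g' * ω) :
    Φ.trMap g' ∘ₗ ρ₁.beta h = ρ₂.beta h ∘ₗ Φ.trMap g :=
  LinearMap.ext fun φ => ((Φ.related_trMap φ).beta h).eq_trMap

end Intertwiner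
end Intertwiner
-- Coherence identities for the intertwiner onto the base factor
section Cast

variable {G : Type*} [Group G] {π : G →* ℤˣ} {k : Type*} [CommRing k] {α : TwistedCocycle π k}
  {V : Type*} [Category* V] [Preadditive V] [Linear k V] (ρ : TwistedRep α V)

lemma TwistedRep.map_coord_cast {ι : Type*} {ε : ι → ℤˣ} {γ : ℤˣ} {x y : SProd ε V}
    (f : (⟨x⟩ : Signed γ (SProd ε V)) ⟶ ⟨y⟩) {a b : G} (h : a = b) {i j : ι} (hij : i = j)
    (h₁ : π a = γ * ε i) (h₂ : π b = γ * ε j) :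
    (ρ.F a).map (SProd.coord f i h₁) ≫ (castIso ρ.F h (congrArg y.of hij)).hom =
      (castIso ρ.F h (congrArg x.of hij)).hom ≫ (ρ.F b).map (SProd.coord f j h₂) := by
  subst h hij
  simp [castIso]

lemma TwistedRep.mu_rfl (a b : G) (x : V) : ρ.mu (rfl : a * b = a * b) x = ρ.ψ a b x := by
  ext; simp [TwistedRep.mu, castIso]

lemma TwistedRep.map_push_coord {ι : Type*} {ε : ι → ℤˣ} {γ δ : ℤˣ} {x y : SProd ε V}
    (f : (⟨x⟩ : Signed γ (SProd ε V)) ⟶ ⟨y⟩) (a b : G) (i : ι) (h₀ : δ = γ * ε i)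
    (h₁ : δ = π a * π b) (h₂ : π (a * b) = γ * ε i) :
    (ρ.F a).map (Signed.push (ρ.F b) h₁ (SProd.coord f i h₀)) ≫ (ρ.ψ a b (y.of i)).hom =
      (ρ.ψ a b (x.of i)).hom ≫ (ρ.F (a * b)).map (SProd.coord f i h₂) := by
  obtain rfl : δ = π (a * b) := h₁.trans (π.map_mul a b).symm
  exact ρ.ψ_nat a b _

lemma TwistedRep.exchange_one {s a : G} {x x' : V} (ha : a = 1) (hx : x = x')
    (h : s * a = 1 * s) :
    (ρ.F s).map (Signed.iso (π s) (castIso ρ.F ha hx ≪≫ ρ.ψe x')).hom =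
      (ρ.ψ s a x ≪≫ castIso ρ.F h hx ≪≫ (ρ.ψ 1 s x').symm).hom ≫ (ρ.ψe ((ρ.F s).obj ⟨x'⟩)).hom := by
  subst ha hx
  have h1 := ρ.mu_one_right s x
  have h2 := ρ.mu_one_left s x
  rw [← h2]
  refine Eq.trans (congrArg (ρ.F s).map ?_) (h1.symm.trans ?_)
  · exact congrArg (fun e => (Signed.iso (π s) e).hom) (Iso.refl_trans _)
  · simp [TwistedRep.mu, castIso]

lemma comp_iso_square {C : Type*} [Category* C] {a₁ a₂ b₁ b₂ c₁ c₂ d₁ d₂ : C} {A : a₁ ⟶ a₂}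
    {B : b₁ ⟶ b₂} {C' : c₁ ⟶ c₂} {D : d₁ ⟶ d₂} {p₁ : a₁ ≅ b₁} {p₂ : a₂ ≅ b₂} {q₁ : b₁ ≅ c₁}
    {q₂ : b₂ ≅ c₂} {r₁ : d₁ ≅ c₁} {r₂ : d₂ ≅ c₂} (hp : A ≫ p₂.hom = p₁.hom ≫ B)
    (hq : B ≫ q₂.hom = q₁.hom ≫ C') (hr : D ≫ r₂.hom = r₁.hom ≫ C') :
    A ≫ (p₂ ≪≫ q₂ ≪≫ r₂.symm).hom = (p₁ ≪≫ q₁ ≪≫ r₁.symm).hom ≫ D := by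
  have hr' : C' ≫ r₂.inv = r₁.inv ≫ D := by
    rw [Iso.comp_inv_eq, Category.assoc, hr, Iso.inv_hom_id_assoc]
  simp only [Iso.trans_hom, Iso.symm_hom, Category.assoc]
  rw [reassoc_of% hp, reassoc_of% hq, hr']

/-- The multiplicativity of `κ`, which exchanges `ρ(s) ρ(a)` and `ρ(e) ρ(s)`. Associativity is used
for `(s, a, b)`, `(e, s, b)` and `(e, e', s)`, and `hd` says that the scalar `d` of the induced
representation compensates the three resulting values of `α`. -/
lemma TwistedRep.exchange_mul {s a b b' c e e' : G} {x x₁ x₂ x' : V}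
    (hb : b = b') (hx : x = x₁) (ho : (ρ.F b).obj ⟨x⟩ = (ρ.F b').obj ⟨x₁⟩)
    (hab : a * b = c) (hx₂ : x = x₂) (hc : s * c = (e * e') * s) (hx₂' : x₂ = x')
    (ha : s * a = e * s) (hb' : s * b' = e' * s) (hx₁ : x₁ = x') (d : kˣ)
    (hd : d * α.val s a b * α.val e e' s = α.val e s b) :
    (ρ.F s).map ((d : k) • (Signed.iso (π s) (ρ.ψ a b x ≪≫ castIso ρ.F hab hx₂)).hom) ≫
        (ρ.ψ s c x₂ ≪≫ castIso ρ.F hc hx₂' ≪≫ (ρ.ψ (e * e') s x').symm).hom =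
      (ρ.ψ s a ((ρ.F b).obj ⟨x⟩) ≪≫ castIso ρ.F ha ho ≪≫
          (ρ.ψ e s ((ρ.F b').obj ⟨x₁⟩)).symm).hom ≫
        (ρ.F e).map (Signed.iso (π e) (ρ.ψ s b' x₁ ≪≫ castIso ρ.F hb' hx₁ ≪≫
          (ρ.ψ e' s x').symm)).hom ≫ (ρ.ψ e e' ((ρ.F s).obj ⟨x'⟩)).hom := by
  subst hb hx hx₁ hx₂
  have m : ∀ {p q r : G} (h : p * q = r) (z : V),
      ρ.ψ p q z ≪≫ castIso ρ.F h rfl = ρ.mu h z := fun _ _ => rfl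
  have hr : (e * s) * b = e * e' * s := by rw [mul_assoc, hb', mul_assoc]
  have K1 := ρ.mu_assoc ha hab hr hc x
  have K2 := ρ.mu_assoc (rfl : e * s = _) hb' hr (mul_assoc _ _ _).symm x
  have K3 := ρ.mu_assoc (rfl : e * e' = _) (rfl : e' * s = _) rfl (mul_assoc _ _ _).symm x
  rw [← Iso.trans_assoc, ← Iso.trans_assoc, ← Iso.trans_assoc, m, m, m, m,
    ← mu_rfl, ← mu_rfl, ← mu_rfl, ← mu_rfl]
  rw [← iso_trans_hom (π e), Functor.map_comp, Functor.map_smul]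
  simp only [Iso.trans_hom, Iso.symm_hom, Category.assoc, Linear.smul_comp]
  rw [reassoc_of% K1]
  have h3 : (ρ.F e).map (Signed.iso (π e) (ρ.mu (rfl : e' * s = _) x).symm).hom ≫
      (ρ.mu (rfl : e * e' = _) ((ρ.F s).obj ⟨x⟩)).hom =
      (((α.val e e' s)⁻¹ : kˣ) : k) • ((ρ.mu (mul_assoc _ _ _).symm x).hom ≫
        (ρ.mu (rfl : e * e' * s = _) x).inv) := by
    rw [← Linear.smul_comp, Iso.eq_comp_inv, Category.assoc, eq_units_inv_smul K3,
      Linear.comp_smul, ← Category.assoc, ← Functor.map_comp, iso_trans_hom, Iso.symm_self_id]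
    exact congrArg (_ • ·) ((congrArg (· ≫ _) ((ρ.F e).map_id _)).trans (Category.id_comp _))
  rw [h3, Linear.comp_smul, Linear.comp_smul, Linear.comp_smul, reassoc_of% K2]
  simp only [Linear.smul_comp, Linear.comp_smul, Category.assoc, Iso.inv_hom_id_assoc, smul_smul,
    ← Units.val_mul]
  congr 2
  rw [← hd]
  rw [mul_comm (d * α.val s a b), inv_mul_cancel_left]

end Cast

/-! ### The intertwiner from the restriction of the induced representation to `ρ` -/

namespace RInd

variable {G : Type*} [Group G] {π : G →* ℤˣ} {H : Subgroup G} {k : Type*} [CommRing k]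
  {α : TwistedCocycle π k} {V : Type*} [Category* V] [Preadditive V] [Linear k V]
  (ρ : TwistedRep (α.res H) V) (S : CosetReps H)

/-- The trivial coset. -/
abbrev base (H : Subgroup G) : G ⧸ H := ((1 : G) : G ⧸ H)

lemma smul_base_eq_iff (a : G) : a • base H = base H ↔ a ∈ H := by
  rw [MulAction.Quotient.smul_coe, smul_eq_mul, mul_one, eq_comm, QuotientGroup.eq]
  simp

lemma inv_smul_base (h : H) : (h : G)⁻¹ • base H = base H :=
  (smul_base_eq_iff _).mpr (inv_mem h.2)

/-- The representative of the trivial coset, as an element of the subgroup. -/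
def baseRep : H := ⟨S.s (base H), by
  rw [← smul_base_eq_iff, MulAction.Quotient.smul_coe, smul_eq_mul, mul_one, S.mk_s]⟩

lemma baseRep_mul (h : H) : baseRep S * S.eta h (base H) = h * baseRep S := by
  apply Subtype.ext
  have := S.s_mul_eta h (base H)
  rw [inv_smul_base] at this
  exact this

/-- The functor `∏ i, ^π(σ_i) V ⥤ V`, composed of the projection to the factor of the trivial coset
and the action of the representative of this coset. -/
@[simps]
def baseFunctor : Cat π S V ⥤ V where
  obj x := (ρ.F (baseRep S)).obj ⟨x.of (base H)⟩
  map f := (ρ.F (baseRep S)).map (f.app (base H))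
  map_id _ := (ρ.F (baseRep S)).map_id _
  map_comp _ _ := (ρ.F (baseRep S)).map_comp _ _

lemma mapHom_baseFunctor {γ γ' : ℤˣ} {x y : Cat π S V}
    (f : (⟨x⟩ : Signed γ (Cat π S V)) ⟶ ⟨y⟩) (h₁ : γ' = γ * π (S.s (base H)))
    (h₂ : γ' = γ * resGrading π H (baseRep S)) :
    Signed.mapHom (baseFunctor ρ S) f = Signed.push (ρ.F (baseRep S)) h₂
      (SProd.coord f (base H) h₁) := by
  ext h
  · rw [SProd.coord_pos _ _ _ h]; rfl
  · rw [SProd.coord_neg _ _ _ h]; rfl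

/-- Elements of `H` fix the trivial coset, so the three representatives in `coeff` are the same
element of `H`. This is the scalar identity that `exchange_mul` requires. -/
lemma coeff_base (h₂ h₁ : H) :
    S.coeff α h₂ h₁ (base H) * α.val (baseRep S) (S.eta h₂ (base H))
      (S.eta h₁ ((h₂ : G)⁻¹ • base H)) * α.val h₂ h₁ (baseRep S) =
      α.val h₂ (baseRep S) (S.eta h₁ ((h₂ : G)⁻¹ • base H)) := by
  rw [CosetReps.coeff, inv_smul_base h₂, inv_smul_base h₁]
  have aux : ∀ A B C : kˣ, A / (B * C) * C * B = A := fun A B C => by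
    rw [mul_assoc, mul_comm C B, div_mul_cancel]
  exact aux _ _ _

/-- The functor `baseFunctor` is an intertwiner from the restriction of the induced representation
to the original one. -/
def baseIntertwiner : Intertwiner ((RInd ρ S).res H) ρ where
  P := baseFunctor ρ S
  κ h x := ρ.ψ (baseRep S) (S.eta h (base H)) (x.of ((h : G)⁻¹ • base H)) ≪≫
    castIso ρ.F (baseRep_mul S h) (congrArg x.of (inv_smul_base h)) ≪≫
      (ρ.ψ h (baseRep S) (x.of (base H))).symm
  κ_nat h {x y} f := by
    have e : π (h : G) * π (S.s ((h : G)⁻¹ • base H)) =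
        resGrading π H (baseRep S * S.eta h (base H)) := by
      rw [S.sign π, map_mul]; rfl
    have e' : π (h : G) * π (S.s (base H)) = resGrading π H (h * baseRep S) := by
      rw [map_mul]; rfl
    have h1 := ρ.map_push_coord f (baseRep S) (S.eta h (base H)) ((h : G)⁻¹ • base H) rfl
      (S.sign π h (base H)) e.symm
    have h2 := ρ.map_coord_cast f (baseRep_mul S h) (inv_smul_base h) e.symm e'.symm
    have h3 := ρ.map_push_coord f h (baseRep S) (base H) (δ := π (h : G) * π (S.s (base H))) rfl rfl
      e'.symm
    rw [mapHom_baseFunctor ρ S f rfl rfl]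
    exact comp_iso_square h1 h2 h3
  κ_mul b a x := ρ.exchange_mul (congrArg (S.eta (a : G)) (inv_smul_base b))
    (congrArg (fun i => x.of ((a : G)⁻¹ • i)) (inv_smul_base b))
    (congrArg ((F ρ S a).obj ⟨x⟩).of (inv_smul_base b)) (S.eta_mul b a (base H))
    (congrArg x.of (CosetReps.idx_mul (b : G) a (base H))) (baseRep_mul S (b * a))
    (congrArg x.of (inv_smul_base (b * a))) (baseRep_mul S b) (baseRep_mul S a)
    (congrArg x.of (inv_smul_base a)) _ (coeff_base S b a)
  κ_one x := ρ.exchange_one (S.eta_one (base H)) (congrArg x.of (CosetReps.idx_one (base H)))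
    (baseRep_mul S 1)

end RInd
-- The base block and the categorical trace of `ρ`
namespace RInd

section

variable {G : Type*} [Group G] {π : G →* ℤˣ} {H : Subgroup G} {k : Type*} [CommRing k]
  {α : TwistedCocycle π k} {V : Type*} [Category* V] [Preadditive V] [Linear k V]
  (ρ : TwistedRep (α.res H) V) (S : CosetReps H)

instance : (baseFunctor ρ S).Additive where
  map_add := (ρ.F (baseRep S)).map_add

instance : (baseFunctor ρ S).Linear k where
  map_smul _ _ := (ρ.F (baseRep S)).map_smul _ _

/-- The morphism of the product category with a given component at the trivial coset, the other
components being zero. -/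
noncomputable def single {x y : Cat π S V}
    (t : (⟨x.of (base H)⟩ : Signed (π (S.s (base H))) V) ⟶ ⟨y.of (base H)⟩) : x ⟶ y :=
  open Classical in ⟨Function.update (fun _ => 0) (base H) t⟩

lemma single_app_base {x y : Cat π S V}
    (t : (⟨x.of (base H)⟩ : Signed (π (S.s (base H))) V) ⟶ ⟨y.of (base H)⟩) :
    (single S t).app (base H) = t := by
  simp only [single, Function.update_self]

lemma single_app_of_ne {x y : Cat π S V}
    (t : (⟨x.of (base H)⟩ : Signed (π (S.s (base H))) V) ⟶ ⟨y.of (base H)⟩) {i : G ⧸ H}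
    (h : i ≠ base H) : (single S t).app i = 0 := by
  simp [single, h]

lemma exists_baseFunctor_map_single {x y : Cat π S V}
    (f : (baseFunctor ρ S).obj x ⟶ (baseFunctor ρ S).obj y) :
    ∃ t, (baseFunctor ρ S).map (single S (x := x) (y := y) t) = f := by
  have h := (ρ.F (baseRep S)).map_surjective (X := ⟨x.of (base H)⟩) (Y := ⟨y.of (base H)⟩)
  obtain ⟨t, ht⟩ := h f
  exact ⟨t, (congrArg (ρ.F (baseRep S)).map (single_app_base S t)).trans ht⟩

lemma app_base_eq_of_map_eq {x y : Cat π S V} {f f' : x ⟶ y}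
    (h : (baseFunctor ρ S).map f = (baseFunctor ρ S).map f') :
    f.app (base H) = f'.app (base H) :=
  (ρ.F (baseRep S)).map_injective h

instance : (baseFunctor ρ S).Full where
  map_surjective f := (exists_baseFunctor_map_single ρ S f).imp' (single S) fun _ => id

instance : (baseFunctor ρ S).EssSurj where
  mem_essImage v := ⟨⟨fun _ => ((ρ.F (baseRep S)).objPreimage v).of⟩,
    ⟨(ρ.F (baseRep S)).objObjPreimageIso v⟩⟩

instance : (baseIntertwiner ρ S).P.Additive := inferInstanceAs (baseFunctor ρ S).Additive
instance : (baseIntertwiner ρ S).P.Linear k := inferInstanceAs ((baseFunctor ρ S).Linear k)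
instance : (baseIntertwiner ρ S).P.Full := inferInstanceAs (baseFunctor ρ S).Full
instance : (baseIntertwiner ρ S).P.EssSurj := inferInstanceAs (baseFunctor ρ S).EssSurj

/-- An element of degree `+1` of `G` which lies in `H`, as an element of degree `+1` of `H`. -/
abbrev toSubKer {g : π.ker} (hg : (g : G) ∈ H) : (resGrading π H).ker := ⟨⟨g, hg⟩, g.2⟩

/-- For `g` in `H`, the map from the categorical trace of the induced representation to that of
the original one. -/
noncomputable def baseTr {g : π.ker} (hg : (g : G) ∈ H) :
    (RInd ρ S).Tr g →ₗ[k] ρ.Tr (toSubKer hg) :=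
  (baseIntertwiner ρ S).trMap (toSubKer hg)

lemma baseTr_beta (p : GComm π) (h : p.Mem H) :
    baseTr ρ S h.1 ∘ₗ (RInd ρ S).beta p.comm = ρ.beta (p.toSub h).comm ∘ₗ baseTr ρ S h.1 :=
  (baseIntertwiner ρ S).trMap_beta (p.toSub h).comm

lemma related_baseTr {g : π.ker} (hg : (g : G) ∈ H) (φ : (RInd ρ S).Tr g) :
    (baseIntertwiner ρ S).Related (g := toSubKer hg) φ (baseTr ρ S hg φ) :=
  (baseIntertwiner ρ S).related_trMap (g := toSubKer hg) φ

lemma baseTr_block {g : π.ker} (hg : (g : G) ∈ H) :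
    baseTr ρ S hg ∘ₗ block ρ S g (base H) = baseTr ρ S hg := by
  refine LinearMap.ext fun φ => ρ.Tr_ext_of_essSurj (baseFunctor ρ S) fun x => ?_
  refine (related_baseTr ρ S hg _ x).symm.trans (Eq.trans ?_ (related_baseTr ρ S hg φ x))
  refine congrArg (· ≫ _) (congrArg (ρ.F (baseRep S)).map ?_)
  exact (congrArg (· ≫ _) (SProd.proj_app_self (base H) x)).trans (Category.id_comp _)

/-- The action of the representative is faithful on the base component, and the block has no other
components. -/
lemma block_eq_zero_of_baseTr {g : π.ker} (hg : (g : G) ∈ H) {φ : (RInd ρ S).Tr g}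
    (h : baseTr ρ S hg φ = 0) : block ρ S g (base H) φ = 0 := by
  refine (RInd ρ S).Tr_ext fun x => SProd.hom_ext fun i => ?_
  by_cases hi : i = base H
  · subst hi
    have h1 := (baseIntertwiner ρ S).map_ev_eq_zero (h ▸ related_baseTr ρ S hg φ) x
    have h2 := app_base_eq_of_map_eq ρ S (h1.trans ((baseFunctor ρ S).map_zero _ _).symm)
    exact (congrArg (_ ≫ ·) h2).trans Limits.comp_zero
  · exact (congrArg (· ≫ _) (SProd.proj_app_of_ne hi x)).trans Limits.zero_comp

/-- A preimage is obtained by lifting the values of `θ` to the base component and extending by zero.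
Its naturality is checked after `baseFunctor` at the trivial coset and is `0 = 0` at the others. -/
lemma baseTr_surjective {g : π.ker} (hg : (g : G) ∈ H) :
    Function.Surjective (baseTr ρ S hg) := by
  intro θ
  let Φ := baseIntertwiner ρ S
  have hsurj := fun x : Cat π S V => exists_baseFunctor_map_single ρ S (x := x)
    (y := (F ρ S g).obj ⟨x⟩) (ρ.ev θ (Φ.P.obj x) ≫ (Φ.κ ⟨g, hg⟩ x).inv)
  choose t ht using hsurj
  have hnat : ∀ {x y : Cat π S V} (f : x ⟶ y), f ≫ single S (t y) =
      single S (t x) ≫ (F ρ S g).map (Signed.ofOne (MonoidHom.mem_ker.mp g.2) f) := by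
    intro x y f
    refine SProd.hom_ext fun i => ?_
    by_cases hi : i = base H
    · subst hi
      exact app_base_eq_of_map_eq ρ S (Φ.map_naturality (g := toSubKer hg) θ (ht x) (ht y) f)
    · exact ((congrArg (_ ≫ ·) (single_app_of_ne S (t y) hi)).trans Limits.comp_zero).trans
        ((congrArg (· ≫ _) (single_app_of_ne S (t x) hi)).trans Limits.zero_comp).symm
  let φ : (RInd ρ S).Tr g := { app := fun x => single S (t x), naturality := fun _ _ f => hnat f }
  exact ⟨φ, Intertwiner.Related.eq_trMap (Φ := Φ) (g := toSubKer hg) (φ := φ) fun x =>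
    (Iso.eq_comp_inv _).mp (ht x)⟩

end

/-! ### Traces on the blocks and finite dimensionality -/

section Field

variable {G : Type*} [Group G] {π : G →* ℤˣ} {H : Subgroup G} {k : Type*} [Field k]
  {α : TwistedCocycle π k} {V : Type*} [Category* V] [Preadditive V] [Linear k V]
  (ρ : TwistedRep (α.res H) V) (S : CosetReps H)

/-- Any linear section of the surjection `baseTr`, followed by the base block, works. The pair
identifies the range of the block with the categorical trace of `ρ`. -/
lemma exists_section {g : π.ker} (hg : (g : G) ∈ H) :
    ∃ B : ρ.Tr (toSubKer hg) →ₗ[k] (RInd ρ S).Tr g,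
      baseTr ρ S hg ∘ₗ B = LinearMap.id ∧ B ∘ₗ baseTr ρ S hg = block ρ S g (base H) := by
  obtain ⟨B, hB⟩ := (baseTr ρ S hg).exists_rightInverse_of_surjective
    (LinearMap.range_eq_top.mpr (baseTr_surjective ρ S hg))
  refine ⟨block ρ S g (base H) ∘ₗ B, ?_, ?_⟩
  · rw [← LinearMap.comp_assoc, baseTr_block, hB]
  · refine LinearMap.ext fun φ => ?_
    have h : baseTr ρ S hg (B (baseTr ρ S hg φ) - φ) = 0 := by
      rw [map_sub, sub_eq_zero]
      exact LinearMap.congr_fun hB _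
    have h' := block_eq_zero_of_baseTr ρ S hg h
    rwa [map_sub, sub_eq_zero] at h'

lemma trace_beta_block_base [∀ g, FiniteDimensional k ((RInd ρ S).Tr g)]
    [∀ h, FiniteDimensional k (ρ.Tr h)] (p : GComm π) (h : p.Mem H) :
    LinearMap.trace k _ ((RInd ρ S).beta p.comm ∘ₗ block ρ S p.g (base H)) =
      ρ.chi (p.toSub h) := by
  obtain ⟨B, hB, hB'⟩ := exists_section ρ S h.1
  rw [← hB', ← LinearMap.comp_assoc, LinearMap.trace_comp_comm', ← LinearMap.comp_assoc,
    baseTr_beta ρ S p h]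
  exact congrArg _ ((LinearMap.comp_assoc _ _ _).trans
    ((congrArg (_ ∘ₗ ·) hB).trans (LinearMap.comp_id _)))

/-- Conjugation by the bijection `β_σ` preserves the trace, takes block `j` to the base block, and
takes `β_ω` to `ττ⁻¹ β_{σωσ⁻¹}`. -/
lemma trace_beta_block (p : GComm π) (σ : G) {j : G ⧸ H} (hj : σ • j = base H)
    [∀ g, FiniteDimensional k ((RInd ρ S).Tr g)] [∀ h, FiniteDimensional k (ρ.Tr h)]
    (h : (p.conj σ).Mem H) :
    LinearMap.trace k _ ((RInd ρ S).beta p.comm ∘ₗ block ρ S p.g j) =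
      (((α.tautau σ p)⁻¹ : kˣ) : k) * ρ.chi ((p.conj σ).toSub h) := by
  rw [← trace_beta_block_base ρ S]
  let e := LinearEquiv.ofBijective _ ((RInd ρ S).beta_bijective p σ)
  have h1 := (RInd ρ S).beta_conj_comp p σ
  have h3 := beta_block ρ S (TwistedRep.conj_rel p σ) j
  rw [hj] at h3
  rw [← LinearMap.trace_conj' _ e, ← smul_eq_mul, ← map_smul]
  congr 1
  refine LinearMap.ext fun θ => ?_
  obtain ⟨φ, rfl⟩ := e.surjective θ
  rw [LinearEquiv.conj_apply_apply, LinearEquiv.symm_apply_apply]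
  have h1' := LinearMap.congr_fun h1 (block ρ S p.g j φ)
  exact (eq_units_inv_smul (c := α.tautau σ p) h1').trans
    (congrArg (fun θ => (((α.tautau σ p)⁻¹ : kˣ) : k) • (RInd ρ S).beta (p.conj σ).comm θ)
      (LinearMap.congr_fun h3 φ))

/-- The map sends block `j` into the orthogonal block `ωj`, so cyclicity of the trace produces the
product of two orthogonal idempotents. -/
lemma trace_beta_block_eq_zero (p : GComm π) {j : G ⧸ H} (h : p.ω • j ≠ j) :
    LinearMap.trace k _ ((RInd ρ S).beta p.comm ∘ₗ block ρ S p.g j) = 0 := by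
  rw [← block_comp_self, ← LinearMap.comp_assoc, beta_block]
  refine (LinearMap.trace_mul_comm k (block ρ S p.g (p.ω • j) ∘ₗ (RInd ρ S).beta p.comm)
    (block ρ S p.g j)).trans ?_
  rw [Module.End.mul_eq_comp, ← LinearMap.comp_assoc, block_comp_of_ne ρ S p.g h.symm,
    LinearMap.zero_comp, map_zero]

lemma conj_mem_iff (p : GComm π) (σ : G) :
    (p.conj σ).Mem H ↔ (p.g : G) • σ⁻¹ • base H = σ⁻¹ • base H ∧
      p.ω • σ⁻¹ • base H = σ⁻¹ • base H := by
  have key : ∀ a : G, σ * a * σ⁻¹ ∈ H ↔ a • σ⁻¹ • base H = σ⁻¹ • base H := fun a => by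
    rw [← smul_base_eq_iff, mul_smul, mul_smul, eq_inv_smul_iff]
  refine and_congr ?_ (key p.ω)
  refine (key _).trans ?_
  rcases Int.units_eq_one_or (π σ) with h | h
  · simp [h]
  -- For `σ` of degree `-1` the conjugate involves `g⁻¹`, which fixes the same cosets as `g`.
  · rw [h]
    simp only [Units.val_neg, Units.val_one, zpow_neg, zpow_one, InvMemClass.coe_inv]
    rw [inv_smul_eq_iff, eq_comm]

/-- The ranges of the finitely many blocks span, and each block vanishes or factors through a
categorical trace of `ρ`. -/
lemma finiteDimensional_Tr [Finite (G ⧸ H)] [∀ h, FiniteDimensional k (ρ.Tr h)] (g : π.ker) :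
    FiniteDimensional k ((RInd ρ S).Tr g) := by
  have := Fintype.ofFinite (G ⧸ H)
  have hfin : ∀ j, FiniteDimensional k (LinearMap.range (block ρ S g j)) := by
    intro j
    by_cases hj : (g : G) • j = j
    -- Only `g` matters here; the pair is completed by `ω = 1` so that the statements on conjugate
    -- pairs apply.
    · let p : GComm π := ⟨g, 1, by simp⟩
      let σ := (S.s j)⁻¹
      have hσ : σ • j = base H := by
        rw [inv_smul_eq_iff, MulAction.Quotient.smul_coe, smul_eq_mul, mul_one, S.mk_s]
      have hσ' : σ⁻¹ • base H = j := inv_smul_eq_iff.mpr hσ.symm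
      have hm : (p.conj σ).Mem H := (conj_mem_iff p σ).mpr (by rw [hσ']; exact ⟨hj, one_smul _ _⟩)
      obtain ⟨B, -, hB⟩ := exists_section ρ S hm.1
      have h3 := beta_block ρ S (TwistedRep.conj_rel p σ) j
      rw [hσ, ← hB] at h3
      let e := LinearEquiv.ofBijective _ ((RInd ρ S).beta_bijective p σ)
      have h4 : block ρ S g j = ((e.symm : _ →ₗ[k] _) ∘ₗ B) ∘ₗ
          (baseTr ρ S hm.1 ∘ₗ (RInd ρ S).beta (TwistedRep.conj_rel p σ)) := by
        refine LinearMap.ext fun φ => e.injective ?_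
        exact (LinearMap.congr_fun h3 φ).trans (e.apply_symm_apply _).symm
      rw [h4]
      exact Submodule.finiteDimensional_of_le (LinearMap.range_comp_le_range _ _)
    · rw [block_eq_zero ρ S g hj, LinearMap.range_zero]
      infer_instance
  have htop : ⨆ j, LinearMap.range (block ρ S g j) = ⊤ := by
    refine eq_top_iff.mpr fun φ _ => ?_
    rw [← LinearMap.id_apply (R := k) φ, ← sum_block ρ S g, LinearMap.sum_apply]
    exact Submodule.sum_mem _ fun j _ =>
      Submodule.mem_iSup_of_mem j (LinearMap.mem_range_self _ φ)
  have : FiniteDimensional k (⊤ : Submodule k ((RInd ρ S).Tr g)) := by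
    rw [← htop]; infer_instance
  exact Module.Finite.equiv (Submodule.topEquiv (R := k) (M := (RInd ρ S).Tr g))

end Field

/-! ### Counting group elements over cosets -/

section Sum

variable {G : Type*} [Group G]

lemma sum_quotient [Fintype G] (H : Subgroup G) [Fintype (G ⧸ H)] {M : Type*} [Semiring M]
    (f : G ⧸ H → M) : ∑ σ : G, f (σ⁻¹ • base H) = Nat.card H * ∑ j, f j := by
  have := Fintype.ofFinite H
  have h1 : ∑ σ : G, f (σ⁻¹ • base H) = ∑ σ : G, f (σ : G ⧸ H) := by
    refine Fintype.sum_equiv (Equiv.inv G) _ _ fun σ => ?_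
    simp
  have h2 : ∑ σ : G, f (σ : G ⧸ H) = ∑ q : (G ⧸ H) × H, f q.1 :=
    Fintype.sum_equiv Subgroup.groupEquivQuotientProdSubgroup _ _ fun σ => rfl
  rw [h1, h2, Fintype.sum_prod_type]
  simp [Finset.mul_sum, Nat.card_eq_fintype_card]

lemma card_eq_two_mul_card_ker [Finite G] {π : G →* ℤˣ} (hπ : Function.Surjective π) :
    Nat.card G = 2 * Nat.card π.ker := by
  rw [← π.ker.card_mul_index, Subgroup.index_ker, MonoidHom.range_eq_top.mpr hπ, mul_comm]
  simp

end Sum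
end RInd
end Real2

theorem mainTheorem3 {G : Type*} [Group G] [Fintype G] (π : G →* ℤˣ)
    (H : Subgroup G) (hH : Function.Surjective (Real2.resGrading π H))
    {k : Type*} [Field k] (α : Real2.TwistedCocycle π k)
    {V : Type*} [Category* V] [Preadditive V] [Linear k V]
    (ρ : Real2.TwistedRep (α.res H) V) (S : Real2.CosetReps H)
    (hρ : ∀ h, FiniteDimensional k (ρ.Tr h))
    (hk : (2 * Nat.card (Real2.resGrading π H).ker : k) ≠ 0) :
    (∀ g, FiniteDimensional k ((Real2.RInd ρ S).Tr g)) ∧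
      ∀ p : Real2.GComm π, (Real2.RInd ρ S).chi p =
        (2 * Nat.card (Real2.resGrading π H).ker : k)⁻¹ *
          ∑ σ : {σ : G // (p.conj σ).Mem H},
            (((α.tautau σ p)⁻¹ : kˣ) : k) * ρ.chi ((p.conj σ).toSub σ.2) := by
  classical
  have hfin := fun g => Real2.RInd.finiteDimensional_Tr ρ S g
  refine ⟨hfin, fun p => ?_⟩
  have := Fintype.ofFinite (G ⧸ H)
  let f : G ⧸ H → k := fun j => LinearMap.trace k _
    ((Real2.RInd ρ S).beta p.comm ∘ₗ Real2.RInd.block ρ S p.g j)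
  have hchi : (Real2.RInd ρ S).chi p = ∑ j, f j := by
    rw [← map_sum]
    refine congrArg (LinearMap.trace k _) ?_
    refine Eq.trans ?_ (Finset.mul_sum Finset.univ (Real2.RInd.block ρ S p.g)
      ((Real2.RInd ρ S).beta p.comm : Module.End k _))
    rw [Real2.RInd.sum_block]
    rfl
  have hsum : ∑ σ : {σ : G // (p.conj σ).Mem H},
      (((α.tautau σ p)⁻¹ : kˣ) : k) * ρ.chi ((p.conj σ).toSub σ.2) =
        ∑ σ : G, f (σ⁻¹ • Real2.RInd.base H) := by
    -- The sum over all `σ` has no further terms: if the conjugate pair is not in `H`, then `g` or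
    -- `ω` moves the coset of `σ⁻¹` and the trace on its block vanishes.
    rw [← Finset.sum_filter_of_ne (p := fun σ => (p.conj σ).Mem H),
      Finset.sum_subtype _ (p := fun σ => (p.conj σ).Mem H) (fun _ => by simp)]
    · exact Finset.sum_congr rfl fun σ _ =>
        (Real2.RInd.trace_beta_block ρ S p σ (smul_inv_smul _ _) σ.2).symm
    · intro σ _ hσ
      refine (Real2.RInd.conj_mem_iff p σ).mpr ⟨?_, ?_⟩ <;> by_contra hne <;> apply hσ
      · simp only [f]
        rw [Real2.RInd.block_eq_zero ρ S p.g hne, LinearMap.comp_zero, map_zero]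
      · exact Real2.RInd.trace_beta_block_eq_zero ρ S p hne
  -- Every coset is counted `|H|` times. As the grading is onto on `H`, this number is twice the
  -- order of its kernel and cancels the prefactor.
  rw [hsum, Real2.RInd.sum_quotient, ← hchi, Real2.RInd.card_eq_two_mul_card_ker hH]
  push_cast
  rw [inv_mul_cancel_left₀ hk]
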